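/- Let $\mathbf{k}$ be a field of characteristic zero. For $n\ge 0$ let $\mathfrak{lie}_n=\prod_{m\ge 1}\mathfrak{lie}^m(x_1,\dots,x_n)$ be the degree completion of the free Lie algebra over $\mathbf{k}$ on $x_1,\dots,x_n$ (for $n\le 3$ the generators are written $x,y,z$), and let $\mathfrak{tder}_n$ be the space of tangential derivations of $\mathfrak{lie}_n$, i.e. of the derivations $u$ for which there are $a_1,\dots,a_n\in\mathfrak{lie}_n$ with $u(x_i)=[x_i,a_i]$ for all $i$. The $a_i$ are unique if one requires that the coefficient of $x_i$ in the linear part of $a_i$ vanishes for every $i$; with this normalization one writes $u=(a_1,\dots,a_n)$. For $u=(a_1,\dots,a_n)\in\mathfrak{tder}_n$ define the following elements of $\mathfrak{tder}_{n+1}$: $$u^{2,3,\dots,n+1}=(0,a_1(x_2,\dots,x_{n+1}),\dots,a_n(x_2,\dots,x_{n+1})),\qquad u^{1,2,\dots,n}=(a_1,\dots,a_n,0),$$ and, for $1\le i\le n$, $u^{1,\dots,i(i+1),\dots,n+1}=(\tilde a_1,\dots,\tilde a_i,\tilde a_i,\tilde a_{i+1},\dots,\tilde a_n)$, where $\tilde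 a_j=a_j(x_1,\dots,x_{i-1},x_i+x_{i+1},x_{i+2},\dots,x_{n+1})$. Let $d:\mathfrak{tder}_n\to\mathfrak{tder}_{n+1}$ be the differential $$d u=u^{2,3,\dots,n+1}+\sum_{i=1}^{n}(-1)^i\,u^{1,\dots,i(i+1),\dots,n+1}+(-1)^{n+1}u^{1,2,\dots,n},$$ which satisfies $d^2=0$, and let $H^n(\mathfrak{tder},d)=\ker(d:\mathfrak{tder}_n\to\mathfrak{tder}_{n+1})/\operatorname{im}(d:\mathfrak{tder}_{n-1}\to\mathfrak{tder}_n)$. Then: 1. $H^2(\mathfrak{tder},d)=\ker(d:\mathfrak{tder}_2\to\mathfrak{tder}_3)$ (that is, the projection of the kernel onto $H^2$ is bijective), and this space is $\mathbf{k}\,r\oplus\mathbf{k}\,t$, where $r=(y,0)$ and $t=(y,x)$ are linearly independent. 2. $H^3(\mathfrak{tder},d)$ is one-dimensional: $(0,[z,x],0)\in\mathfrak{tder}_3$ is a cocycle, and its class is non-zero and spans $H^3(\mathfrak{tder},d)$. -/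

import Mathlib

namespace TangentialDer

noncomputable section

/-! ### The degree-completed free Lie algebra -/

section Homogeneous

variable {k : Type*} [Field k] {n : ℕ}

/-- `IsLieWord d w`: `w` is a Lie word (iterated bracket of generators) with `d` letters. -/
inductive IsLieWord : ℕ → FreeLieAlgebra k (Fin n) → Prop
  | gen (i : Fin n) : IsLieWord 1 (FreeLieAlgebra.of k i)
  | brk {p q : ℕ} {a b : FreeLieAlgebra k (Fin n)} :
      IsLieWord p a → IsLieWord q b → IsLieWord (p + q) ⁅a, b⁆

variable (k n) in
/-- The degree `d` part of the free Lie algebra: the span of the Lie words with `d` letters. -/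
def lieHomog (d : ℕ) : Submodule k (FreeLieAlgebra k (Fin n)) :=
  Submodule.span k {w | IsLieWord d w}

theorem IsLieWord.mem {d : ℕ} {w : FreeLieAlgebra k (Fin n)} (h : IsLieWord d w) :
    w ∈ lieHomog k n d := Submodule.subset_span h

theorem IsLieWord.one_le {d : ℕ} {w : FreeLieAlgebra k (Fin n)} (h : IsLieWord d w) :
    1 ≤ d := by
  induction h with
  | gen i => exact le_rfl
  | brk _ _ h1 h2 => omega

theorem lieHomog_zero {a : FreeLieAlgebra k (Fin n)} (ha : a ∈ lieHomog k n 0) : a = 0 := by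
  have : {w : FreeLieAlgebra k (Fin n) | IsLieWord 0 w} = ∅ := by
    ext w
    simp only [Set.mem_ofPred_eq, Set.mem_empty_iff_false, iff_false]
    intro h
    have := h.one_le
    omega
  rw [lieHomog, this, Submodule.span_empty] at ha
  simpa using ha

theorem lie_mem_lieHomog {p q : ℕ} {a b : FreeLieAlgebra k (Fin n)}
    (ha : a ∈ lieHomog k n p) (hb : b ∈ lieHomog k n q) : ⁅a, b⁆ ∈ lieHomog k n (p + q) := by
  induction ha using Submodule.span_induction with
  | mem x hx =>
    induction hb using Submodule.span_induction with
    | mem y hy => exact (IsLieWord.brk hx hy).mem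
    | zero => simp
    | add y z _ _ h1 h2 => rw [lie_add]; exact add_mem h1 h2
    | smul c y _ h1 => rw [lie_smul]; exact Submodule.smul_mem _ _ h1
  | zero => simp
  | add y z _ _ h1 h2 => rw [add_lie]; exact add_mem h1 h2
  | smul c y _ h1 => rw [smul_lie]; exact Submodule.smul_mem _ _ h1

end Homogeneous

/-- The degree completion `∏_{d ≥ 1} lie^d(x_1, …, x_n)` of the free Lie algebra over `k` on
`n` generators (the factor with index `0` is the zero space). -/
def CLie (k : Type*) [Field k] (n : ℕ) : Type _ := (d : ℕ) → lieHomog k n d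

namespace CLie

variable {k : Type*} [Field k] {n m : ℕ}

instance : AddCommGroup (CLie k n) := inferInstanceAs (AddCommGroup ((d : ℕ) → lieHomog k n d))

instance : Module k (CLie k n) := inferInstanceAs (Module k ((d : ℕ) → lieHomog k n d))

/-- The homogeneous component of degree `d`, as an element of the free Lie algebra. -/
def comp (a : CLie k n) (d : ℕ) : FreeLieAlgebra k (Fin n) := (a d : FreeLieAlgebra k (Fin n))

/-- An element of the completion from the sequence of its homogeneous components. -/
def mk (f : ℕ → FreeLieAlgebra k (Fin n)) (hf : ∀ d, f d ∈ lieHomog k n d) : CLie k n :=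
  fun d => ⟨f d, hf d⟩

theorem comp_mem (a : CLie k n) (d : ℕ) : a.comp d ∈ lieHomog k n d := (a d).2

@[simp] theorem comp_mk (f : ℕ → FreeLieAlgebra k (Fin n)) (hf : ∀ d, f d ∈ lieHomog k n d)
    (d : ℕ) : (mk f hf).comp d = f d := rfl

@[ext] theorem ext {a b : CLie k n} (h : ∀ d, a.comp d = b.comp d) : a = b :=
  funext fun d => Subtype.ext (h d)

@[simp] theorem comp_zero (d : ℕ) : (0 : CLie k n).comp d = 0 := rfl
@[simp] theorem comp_add (a b : CLie k n) (d : ℕ) : (a + b).comp d = a.comp d + b.comp d := rfl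
@[simp] theorem comp_sub (a b : CLie k n) (d : ℕ) : (a - b).comp d = a.comp d - b.comp d := rfl
@[simp] theorem comp_neg (a : CLie k n) (d : ℕ) : (-a).comp d = -a.comp d := rfl
@[simp] theorem comp_smul (c : k) (a : CLie k n) (d : ℕ) : (c • a).comp d = c • a.comp d := rfl

variable (k n) in
/-- Taking the component of degree `d`, as a linear map. -/
def compₗ (d : ℕ) : CLie k n →ₗ[k] FreeLieAlgebra k (Fin n) where
  toFun a := a.comp d
  map_add' _ _ := rfl
  map_smul' _ _ := rfl

@[simp] theorem comp_sum {ι : Type*} (s : Finset ι) (f : ι → CLie k n) (d : ℕ) :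
    (∑ i ∈ s, f i).comp d = ∑ i ∈ s, (f i).comp d :=
  map_sum (compₗ k n d) f s

@[simp] theorem comp_zero_right (a : CLie k n) : a.comp 0 = 0 := lieHomog_zero (a.comp_mem 0)

theorem sum_triple {M : Type*} [AddCommMonoid M] (T : ℕ → ℕ → ℕ → M) (d : ℕ) :
    ∑ p ∈ Finset.HasAntidiagonal.antidiagonal d, ∑ q ∈ Finset.HasAntidiagonal.antidiagonal p.2, T p.1 q.1 q.2 =
      ∑ p ∈ Finset.HasAntidiagonal.antidiagonal d, ∑ q ∈ Finset.HasAntidiagonal.antidiagonal p.1, T q.1 q.2 p.2 := by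
  rw [Finset.sum_sigma', Finset.sum_sigma']
  refine Finset.sum_nbij' (fun x => ⟨(x.1.1 + x.2.1, x.2.2), (x.1.1, x.2.1)⟩)
    (fun x => ⟨(x.2.1, x.2.2 + x.1.2), (x.2.2, x.1.2)⟩) ?_ ?_ ?_ ?_ ?_
  all_goals
    rintro ⟨⟨a, b⟩, ⟨c, e⟩⟩ h
    simp only [Finset.mem_sigma, Finset.HasAntidiagonal.mem_antidiagonal] at h ⊢
  · exact ⟨by omega, trivial⟩
  · exact ⟨by omega, trivial⟩
  · obtain ⟨h1, h2⟩ := h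
    subst h2
    rfl
  · obtain ⟨h1, h2⟩ := h
    subst h2
    rfl

theorem sum_swap {M : Type*} [AddCommMonoid M] (T : ℕ → ℕ → M) (d : ℕ) :
    ∑ q ∈ Finset.HasAntidiagonal.antidiagonal d, T q.1 q.2 = ∑ q ∈ Finset.HasAntidiagonal.antidiagonal d, T q.2 q.1 :=
  (Finset.Nat.sum_antidiagonal_swap (f := fun q => T q.1 q.2)).symm

/-- The bracket, extended degree by degree: `⁅a, b⁆_d = ∑_{p+q=d} ⁅a_p, b_q⁆`. -/
instance : Bracket (CLie k n) (CLie k n) where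
  bracket a b := mk (fun d => ∑ p ∈ Finset.HasAntidiagonal.antidiagonal d, ⁅a.comp p.1, b.comp p.2⁆) fun d =>
    Submodule.sum_mem _ fun p hp => by
      rw [← Finset.HasAntidiagonal.mem_antidiagonal.1 hp]
      exact lie_mem_lieHomog (a.comp_mem _) (b.comp_mem _)

theorem comp_lie (a b : CLie k n) (d : ℕ) :
    ⁅a, b⁆.comp d = ∑ p ∈ Finset.HasAntidiagonal.antidiagonal d, ⁅a.comp p.1, b.comp p.2⁆ := rfl

instance : LieRing (CLie k n) where
  add_lie a b c := by ext d; simp [comp_lie, Finset.sum_add_distrib]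
  lie_add a b c := by ext d; simp [comp_lie, Finset.sum_add_distrib]
  lie_self a := by
    ext d
    rw [comp_lie, comp_zero]
    refine Finset.sum_involution (fun p _ => p.swap) ?_ ?_ ?_ ?_
    · intro p _
      rw [← lie_skew (a.comp p.1) (a.comp p.2)]
      exact neg_add_cancel _
    · intro p _ hp h
      apply hp
      have : p.2 = p.1 := congrArg Prod.fst h
      rw [this, lie_self]
    · intro p hp
      simpa [add_comm] using hp
    · intro p _
      simp
  leibniz_lie a b c := by
    ext d
    simp only [comp_lie, comp_add, lie_sum, sum_lie]
    rw [sum_triple (fun i j l => ⁅a.comp i, ⁅b.comp j, c.comp l⁆⁆),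
      sum_triple (fun i j l => ⁅b.comp i, ⁅a.comp j, c.comp l⁆⁆), ← Finset.sum_add_distrib]
    refine Finset.sum_congr rfl fun p _ => ?_
    rw [sum_swap (fun i j => ⁅b.comp i, ⁅a.comp j, c.comp p.2⁆⁆), ← Finset.sum_add_distrib]
    exact Finset.sum_congr rfl fun q _ => leibniz_lie _ _ _

instance : LieAlgebra k (CLie k n) where
  lie_smul t a b := by ext d; simp [comp_lie, Finset.smul_sum]

variable (k) in
/-- The generators `x_1, …, x_n` (indexed by `Fin n`, so from `0`). -/
def X (i : Fin n) : CLie k n :=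
  mk (fun d => if d = 1 then FreeLieAlgebra.of k i else 0) fun d => by
    split_ifs with h
    · subst h
      exact (IsLieWord.gen i).mem
    · exact zero_mem _

theorem comp_X (i : Fin n) (d : ℕ) :
    (X k i).comp d = if d = 1 then FreeLieAlgebra.of k i else 0 := rfl

theorem comp_X_lie (i : Fin n) (a : CLie k n) (d : ℕ) :
    ⁅X k i, a⁆.comp (d + 1) = ⁅FreeLieAlgebra.of k i, a.comp d⁆ := by
  rw [comp_lie, Finset.sum_eq_single (1, d)]
  · simp [comp_X]
  · rintro ⟨p, q⟩ hp hne
    have : p ≠ 1 := by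
      rintro rfl
      apply hne
      simp only [Finset.HasAntidiagonal.mem_antidiagonal] at hp
      ext <;> simp; omega
    simp [comp_X, this]
  · intro h
    simp [add_comm] at h

/-- `subst y a = a(y_1, …, y_n)`: substitution of elements `y_i` of degree one for the
generators. -/
def subst (y : Fin n → lieHomog k m 1) : CLie k n →ₗ[k] CLie k m where
  toFun a := mk (fun d => FreeLieAlgebra.lift k (fun i => (y i : FreeLieAlgebra k (Fin m)))
      (a.comp d)) fun d => by
    have key : ∀ w ∈ lieHomog k n d,
        FreeLieAlgebra.lift k (fun i => (y i : FreeLieAlgebra k (Fin m))) w ∈ lieHomog k m d := by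
      intro w hw
      induction hw using Submodule.span_induction with
      | mem x hx =>
        induction hx with
        | gen i => rw [FreeLieAlgebra.lift_of_apply]; exact (y i).2
        | brk _ _ h1 h2 => rw [LieHom.map_lie]; exact lie_mem_lieHomog h1 h2
      | zero => simp
      | add u v _ _ h1 h2 => rw [map_add]; exact add_mem h1 h2
      | smul c u _ h1 => rw [map_smul]; exact Submodule.smul_mem _ _ h1
    exact key _ (a.comp_mem d)
  map_add' a b := ext fun d => map_add _ (a.comp d) (b.comp d)
  map_smul' c a := ext fun d => map_smul _ c (a.comp d)

theorem comp_subst (y : Fin n → lieHomog k m 1) (a : CLie k n) (d : ℕ) :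
    (subst y a).comp d =
      FreeLieAlgebra.lift k (fun i => (y i : FreeLieAlgebra k (Fin m))) (a.comp d) := rfl

section Coefficient

attribute [local instance 100] LieRing.ofAssociativeRing

variable (k) in
/-- The coefficient of the generator `x_j` in an element of the free Lie algebra: the
homomorphism to the abelian Lie algebra `k` with `x_j ↦ 1` and `x_i ↦ 0` for `i ≠ j`. -/
def freeCoeff (j : Fin n) : FreeLieAlgebra k (Fin n) →ₗ[k] k :=
  (FreeLieAlgebra.lift k (Pi.single j (1 : k) : Fin n → k) : FreeLieAlgebra k (Fin n) →ₗ⁅k⁆ k)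

theorem freeCoeff_of (j i : Fin n) :
    freeCoeff k j (FreeLieAlgebra.of k i) = if i = j then 1 else 0 := by
  simp [freeCoeff, Pi.single_apply]

theorem freeCoeff_lie (j : Fin n) (a b : FreeLieAlgebra k (Fin n)) :
    freeCoeff k j ⁅a, b⁆ = 0 := by
  change (FreeLieAlgebra.lift k (Pi.single j (1 : k) : Fin n → k)) ⁅a, b⁆ = 0
  rw [LieHom.map_lie, LieRing.of_associative_ring_bracket, mul_comm, sub_self]

end Coefficient

theorem freeCoeff_eq_zero (j : Fin n) {d : ℕ} (hd : d ≠ 1) {a : FreeLieAlgebra k (Fin n)}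
    (ha : a ∈ lieHomog k n d) : freeCoeff k j a = 0 := by
  induction ha using Submodule.span_induction with
  | mem x hx =>
    cases hx with
    | gen i => exact absurd rfl hd
    | brk _ _ => exact freeCoeff_lie _ _ _
  | zero => simp
  | add u v _ _ h1 h2 => rw [map_add, h1, h2, add_zero]
  | smul c u _ h1 => rw [map_smul, h1, smul_zero]

variable (k) in
/-- The projection `p_j` taking the coefficient of `x_j` in the degree one part. -/
def proj (j : Fin n) : CLie k n →ₗ[k] k := freeCoeff k j ∘ₗ compₗ k n 1

theorem proj_apply (j : Fin n) (a : CLie k n) : proj k j a = freeCoeff k j (a.comp 1) := rfl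

theorem proj_X (j i : Fin n) : proj k j (X k i) = if i = j then 1 else 0 := by
  rw [proj_apply, comp_X, if_pos rfl, freeCoeff_of]

theorem proj_lie (j : Fin n) (a b : CLie k n) : proj k j ⁅a, b⁆ = 0 := by
  rw [proj_apply, comp_lie, map_sum]
  exact Finset.sum_eq_zero fun p _ => freeCoeff_lie _ _ _

theorem lieHomog_one {a : FreeLieAlgebra k (Fin n)} (ha : a ∈ lieHomog k n 1) :
    a = ∑ i, freeCoeff k i a • FreeLieAlgebra.of k i := by
  induction ha using Submodule.span_induction with
  | mem x hx =>
    generalize hd : 1 = d at hx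
    cases hx with
    | gen i => simp [freeCoeff_of]
    | brk h1 h2 =>
      have := h1.one_le
      have := h2.one_le
      omega
  | zero => simp
  | add u v _ _ h1 h2 =>
    conv_lhs => rw [h1, h2]
    simp [add_smul, Finset.sum_add_distrib]
  | smul c u _ h1 =>
    conv_lhs => rw [h1]
    simp [Finset.smul_sum, mul_smul]

/-- Every homogeneous element of degree at least two is a sum of brackets `⁅x_i, b_i⁆`. -/
theorem lieHomog_succ {d : ℕ} (hd : 1 ≤ d) {a : FreeLieAlgebra k (Fin n)}
    (ha : a ∈ lieHomog k n (d + 1)) :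
    ∃ b : Fin n → FreeLieAlgebra k (Fin n), (∀ i, b i ∈ lieHomog k n d) ∧
      a = ∑ i, ⁅FreeLieAlgebra.of k i, b i⁆ := by
  let T : ℕ → Submodule k (FreeLieAlgebra k (Fin n)) := fun e =>
    { carrier := {a | ∃ b : Fin n → FreeLieAlgebra k (Fin n), (∀ i, b i ∈ lieHomog k n e) ∧
        a = ∑ i, ⁅FreeLieAlgebra.of k i, b i⁆}
      zero_mem' := ⟨0, fun i => zero_mem _, by simp⟩
      add_mem' := by
        rintro _ _ ⟨b, hb, rfl⟩ ⟨c, hc, rfl⟩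
        exact ⟨b + c, fun i => add_mem (hb i) (hc i), by simp [Finset.sum_add_distrib]⟩
      smul_mem' := by
        rintro t _ ⟨b, hb, rfl⟩
        exact ⟨t • b, fun i => Submodule.smul_mem _ _ (hb i), by simp [Finset.smul_sum]⟩ }
  have key : ∀ {p : ℕ} {u : FreeLieAlgebra k (Fin n)}, IsLieWord p u → ∀ {q e : ℕ},
      p + q = e + 1 → ∀ v ∈ lieHomog k n q, ⁅u, v⁆ ∈ T e := by
    intro p u hu
    induction hu with
    | gen i =>
      intro q e he v hv
      obtain rfl : q = e := by omega
      refine ⟨Pi.single i v, fun j => ?_, ?_⟩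
      · by_cases h : j = i
        · subst h; simpa using hv
        · simp [h]
      · rw [Finset.sum_eq_single i]
        · simp
        · intro j _ hj; simp [hj]
        · simp
    | brk h1 h2 ih1 ih2 =>
      intro q e he v hv
      rw [lie_lie]
      exact sub_mem (ih1 (by omega) _ (lie_mem_lieHomog h2.mem hv))
        (ih2 (by omega) _ (lie_mem_lieHomog h1.mem hv))
  change a ∈ T d
  refine (Submodule.span_le (p := T d)).2 ?_ ha
  intro w hw
  have hw : IsLieWord (d + 1) w := hw
  generalize he : d + 1 = e at hw
  cases hw with
  | gen i => omega
  | brk h1 h2 => exact key h1 he.symm _ h2.mem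

/-- Every Lie series is a linear combination of generators plus a sum of `⁅x_i, b_i⁆`. -/
theorem decompose (a : CLie k n) :
    ∃ b : Fin n → CLie k n, a = ∑ i, proj k i a • X k i + ∑ i, ⁅X k i, b i⁆ := by
  have h : ∀ d : ℕ, ∃ b : Fin n → FreeLieAlgebra k (Fin n), (∀ i, b i ∈ lieHomog k n d) ∧
      (1 ≤ d → a.comp (d + 1) = ∑ i, ⁅FreeLieAlgebra.of k i, b i⁆) := by
    intro d
    by_cases hd : 1 ≤ d
    · obtain ⟨b, hb, h⟩ := lieHomog_succ hd (a.comp_mem (d + 1))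
      exact ⟨b, hb, fun _ => h⟩
    · exact ⟨0, fun i => zero_mem _, fun h => absurd h hd⟩
  choose b hb h using h
  refine ⟨fun i => mk (fun d => b d i) fun d => hb d i, ?_⟩
  ext d
  match d with
  | 0 => simp
  | 1 =>
    simp only [comp_add, comp_sum, comp_smul, comp_X, if_true]
    rw [Finset.sum_congr rfl fun i _ => comp_X_lie i _ 0]
    simp only [comp_zero_right, lie_zero, Finset.sum_const_zero, add_zero]
    exact lieHomog_one (a.comp_mem 1)
  | d + 2 =>
    simp only [comp_add, comp_sum, comp_smul, comp_X]
    rw [Finset.sum_congr rfl fun i _ => comp_X_lie i _ (d + 1)]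
    simpa using h (d + 1) (by omega)

/-- A derivation of the completed free Lie algebra is determined by its values on generators. -/
theorem derivation_ext {u v : LieDerivation k (CLie k n) (CLie k n)}
    (h : ∀ i, u (X k i) = v (X k i)) : u = v := by
  have key : ∀ (d : ℕ) (a : CLie k n), (u a).comp d = (v a).comp d := by
    intro d
    induction d with
    | zero => simp
    | succ d ih =>
      intro a
      obtain ⟨b, hb⟩ := decompose a
      rw [hb]
      simp only [map_add, map_sum, map_smul, LieDerivation.apply_lie_eq_sub, comp_add, comp_sum,
        comp_smul, comp_sub, comp_X_lie, ih, h]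
  exact LieDerivation.ext fun a => ext fun d => key d a

end CLie

section Free

/-! ### Two facts on free Lie algebras: derivations with prescribed values on the generators,
and the centralizer of a generator -/

attribute [local instance 100] LieRing.ofAssociativeRing

variable {k : Type*} [Field k] {n : ℕ}

/-- Auxiliary: `x_i` acts on `L × k` by `(l, t) ↦ (⁅x_i, l⁆ + t c_i, 0)`. -/
def genAct (c : Fin n → FreeLieAlgebra k (Fin n)) (i : Fin n) :
    Module.End k (FreeLieAlgebra k (Fin n) × k) where
  toFun z := (⁅FreeLieAlgebra.of k i, z.1⁆ + z.2 • c i, 0)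
  map_add' y z := by
    ext
    · simp only [Prod.fst_add, Prod.snd_add, lie_add, add_smul]; abel
    · simp
  map_smul' t z := by
    ext
    · simp [mul_smul]
    · simp

/-- Auxiliary: the derivation of the free Lie algebra with `x_i ↦ c_i`, as a linear map. -/
def freeDer (c : Fin n → FreeLieAlgebra k (Fin n)) :
    FreeLieAlgebra k (Fin n) →ₗ[k] FreeLieAlgebra k (Fin n) where
  toFun a := (FreeLieAlgebra.lift k (genAct c) a (0, 1)).1
  map_add' a b := by simp
  map_smul' t a := by simp

theorem lift_genAct (c : Fin n → FreeLieAlgebra k (Fin n)) {d : ℕ}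
    {a : FreeLieAlgebra k (Fin n)} (ha : a ∈ lieHomog k n d) (l : FreeLieAlgebra k (Fin n))
    (t : k) : FreeLieAlgebra.lift k (genAct c) a (l, t) = (⁅a, l⁆ + t • freeDer c a, 0) := by
  have key : ∀ a ∈ lieHomog k n d, (∀ l, FreeLieAlgebra.lift k (genAct c) a (l, 0) = (⁅a, l⁆, 0)) ∧
      (FreeLieAlgebra.lift k (genAct c) a (0, 1)).2 = 0 := by
    clear ha a
    intro a ha
    induction ha using Submodule.span_induction with
    | mem x hx =>
      induction hx with
      | gen i => rw [FreeLieAlgebra.lift_of_apply]; simp [genAct]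
      | @brk p q u v _ _ h1 h2 =>
        rw [LieHom.map_lie, LieRing.of_associative_ring_bracket]
        have e1 : FreeLieAlgebra.lift k (genAct c) u (0, 1) = (freeDer c u, 0) :=
          Prod.ext rfl h1.2
        have e2 : FreeLieAlgebra.lift k (genAct c) v (0, 1) = (freeDer c v, 0) :=
          Prod.ext rfl h2.2
        constructor
        · intro l
          simp [Module.End.mul_apply, h1.1, h2.1]
        · simp [Module.End.mul_apply, e1, e2, h1.1, h2.1]
    | zero => simp [Prod.ext_iff]
    | add u v _ _ h1 h2 => simp [h1.1, h1.2, h2.1, h2.2]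
    | smul c u _ h1 => simp [h1.1, h1.2]
  obtain ⟨h1, h2⟩ := key a ha
  have e1 : FreeLieAlgebra.lift k (genAct c) a (0, 1) = (freeDer c a, 0) := Prod.ext rfl h2
  have e2 : ((l, t) : FreeLieAlgebra k (Fin n) × k) = (l, 0) + t • (0, 1) := by simp
  rw [e2, map_add, map_smul, h1, e1]
  simp

theorem freeDer_of (c : Fin n → FreeLieAlgebra k (Fin n)) (i : Fin n) :
    freeDer c (FreeLieAlgebra.of k i) = c i := by
  simp [freeDer, genAct]

theorem freeDer_lie (c : Fin n → FreeLieAlgebra k (Fin n)) {p q : ℕ}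
    {a b : FreeLieAlgebra k (Fin n)} (ha : a ∈ lieHomog k n p) (hb : b ∈ lieHomog k n q) :
    freeDer c ⁅a, b⁆ = ⁅a, freeDer c b⁆ - ⁅b, freeDer c a⁆ := by
  change (FreeLieAlgebra.lift k (genAct c) ⁅a, b⁆ (0, 1)).1 = _
  rw [LieHom.map_lie, LieRing.of_associative_ring_bracket]
  simp [Module.End.mul_apply, lift_genAct c ha, lift_genAct c hb]

theorem freeDer_mem (c : Fin n → FreeLieAlgebra k (Fin n)) {e : ℕ}
    (hc : ∀ i, c i ∈ lieHomog k n (e + 1)) {d : ℕ} {a : FreeLieAlgebra k (Fin n)}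
    (ha : a ∈ lieHomog k n d) : freeDer c a ∈ lieHomog k n (e + d) := by
  induction ha using Submodule.span_induction with
  | mem x hx =>
    induction hx with
    | gen i => rw [freeDer_of]; exact hc i
    | @brk p q u v hu hv h1 h2 =>
      rw [freeDer_lie c hu.mem hv.mem]
      refine sub_mem ?_ ?_
      · have := lie_mem_lieHomog hu.mem h2
        rwa [show p + (e + q) = e + (p + q) by omega] at this
      · have := lie_mem_lieHomog hv.mem h1
        rwa [show q + (e + p) = e + (p + q) by omega] at this
  | zero => simp
  | add u v _ _ h1 h2 => rw [map_add]; exact add_mem h1 h2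
  | smul c u _ h1 => rw [map_smul]; exact Submodule.smul_mem _ _ h1

/-- The embedding of the free Lie algebra in the free associative algebra. -/
def toAssoc (k : Type*) [Field k] (n : ℕ) :
    FreeLieAlgebra k (Fin n) →ₗ⁅k⁆ FreeAlgebra k (Fin n) :=
  FreeLieAlgebra.lift k (FreeAlgebra.ι k)

theorem freeDer_euler {d : ℕ} {a : FreeLieAlgebra k (Fin n)} (ha : a ∈ lieHomog k n d) :
    freeDer (FreeLieAlgebra.of k) a = (d : k) • a := by
  induction ha using Submodule.span_induction with
  | mem x hx =>
    induction hx with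
    | gen i => simp [freeDer_of]
    | @brk p q u v hu hv h1 h2 =>
      rw [freeDer_lie _ hu.mem hv.mem, h1, h2, lie_smul, lie_smul, ← lie_skew v u]
      rw [Nat.cast_add, add_smul, smul_neg, ← lie_skew u v]
      simp only [smul_neg]
      abel
  | zero => simp
  | add u v _ _ h1 h2 => rw [map_add, h1, h2, smul_add]
  | smul c u _ h1 => rw [map_smul, h1, smul_comm]

theorem toAssoc_injective [CharZero k] {d : ℕ} {a : FreeLieAlgebra k (Fin n)}
    (ha : a ∈ lieHomog k n d) (h : toAssoc k n a = 0) : a = 0 := by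
  have key : FreeLieAlgebra.lift k (genAct (FreeLieAlgebra.of k)) a =
      FreeAlgebra.lift k (genAct (FreeLieAlgebra.of k)) (toAssoc k n a) := by
    have : FreeLieAlgebra.lift k (genAct (FreeLieAlgebra.of (X := Fin n) k)) =
        ((FreeAlgebra.lift k (genAct (FreeLieAlgebra.of k))).toLieHom).comp (toAssoc k n) := by
      refine FreeLieAlgebra.hom_ext fun i => ?_
      simp [toAssoc]
    rw [this]
    rfl
  rw [h, map_zero] at key
  have h2 : freeDer (FreeLieAlgebra.of k) a = 0 := by
    change (FreeLieAlgebra.lift k (genAct (FreeLieAlgebra.of k)) a (0, 1)).1 = 0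
    rw [key]
    rfl
  rw [freeDer_euler ha] at h2
  by_cases hd : d = 0
  · subst hd
    exact lieHomog_zero ha
  · exact (smul_eq_zero.1 h2).resolve_left (by exact_mod_cast hd)

/-- An element of the free associative algebra commuting with `x` is a polynomial in `x`. -/
theorem exists_aeval_of_commute (x : Fin n) (f : FreeAlgebra k (Fin n))
    (h : FreeAlgebra.ι k x * f = f * FreeAlgebra.ι k x) :
    ∃ q : Polynomial k, f = Polynomial.aeval (FreeAlgebra.ι k x) q := by
  let E := FreeAlgebra.equivMonoidAlgebraFreeMonoid (R := k) (X := Fin n)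
  have hE : E (FreeAlgebra.ι k x) = MonoidAlgebra.single (FreeMonoid.of x) 1 := by
    simp [E, FreeAlgebra.equivMonoidAlgebraFreeMonoid]
  set g := E f with hg
  have hgc : MonoidAlgebra.single (FreeMonoid.of x) 1 * g =
      g * MonoidAlgebra.single (FreeMonoid.of x) 1 := by
    rw [← hE, hg, ← map_mul, h, map_mul]
  have hrot : ∀ w, g.coeff w =
      (g * MonoidAlgebra.single (FreeMonoid.of x) 1).coeff (FreeMonoid.of x * w) := by
    intro w
    rw [← hgc, MonoidAlgebra.coeff_single_mul_mul, one_mul]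
  have key : ∀ (u : List (Fin n)) (m : ℕ),
      g.coeff (FreeMonoid.of x ^ m * FreeMonoid.ofList u) ≠ 0 → ∀ y ∈ u, y = x := by
    intro u
    induction u using List.reverseRecOn with
    | nil => simp
    | append_singleton u y ih =>
      intro m hm
      have e : FreeMonoid.of x * (FreeMonoid.of x ^ m * FreeMonoid.ofList (u ++ [y])) =
          (FreeMonoid.of x ^ (m + 1) * FreeMonoid.ofList u) * FreeMonoid.of y := by
        rw [FreeMonoid.ofList_append, FreeMonoid.ofList_singleton, pow_succ']
        simp only [mul_assoc]
      rw [hrot, e] at hm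
      by_cases hy : y = x
      · subst hy
        rw [MonoidAlgebra.coeff_mul_single_mul, mul_one] at hm
        intro z hz
        rcases List.mem_append.1 hz with hz | hz
        · exact ih _ hm z hz
        · simpa using hz
      · exfalso
        apply hm
        apply MonoidAlgebra.coeff_mul_single_of_forall_mul_ne
        intro v hv
        apply hy
        have := congrArg (fun l => (FreeMonoid.toList l).getLast?) hv
        simpa [FreeMonoid.toList_mul, eq_comm] using this
  have hpow : ∀ u : List (Fin n), (∀ y ∈ u, y = x) →
      FreeMonoid.ofList u = FreeMonoid.of x ^ u.length := by
    intro u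
    induction u with
    | nil => simp
    | cons y u ih =>
      intro h
      rw [FreeMonoid.ofList_cons, ih fun z hz => h z (List.mem_cons_of_mem _ hz),
        h y List.mem_cons_self, List.length_cons, pow_succ']
  have hsupp : ∀ w ∈ g.coeff.support, w = FreeMonoid.of x ^ w.length := by
    intro w hw
    exact hpow (FreeMonoid.toList w) (key (FreeMonoid.toList w) 0 (by simpa using hw))
  have hgs : g = ∑ w ∈ g.coeff.support,
      g.coeff w • (MonoidAlgebra.single (FreeMonoid.of x) (1 : k)) ^ w.length := by
    conv_lhs => rw [← MonoidAlgebra.sum_coeff_single g]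
    refine Finset.sum_congr rfl fun w hw => ?_
    rw [MonoidAlgebra.single_pow, ← hsupp w hw]
    simp
  refine ⟨∑ w ∈ g.coeff.support, g.coeff w • Polynomial.X ^ w.length, ?_⟩
  apply E.injective
  rw [← hg, map_sum, map_sum]
  conv_lhs => rw [hgs]
  refine Finset.sum_congr rfl fun w _ => ?_
  rw [map_smul, map_smul, map_pow, map_pow, Polynomial.aeval_X, hE]

/-- The centralizer of a generator `x_i` in the free Lie algebra is `k x_i`. -/
theorem eq_smul_of_lie_eq_zero [CharZero k] {d : ℕ} (i : Fin n) {a : FreeLieAlgebra k (Fin n)}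
    (ha : a ∈ lieHomog k n d) (h : ⁅FreeLieAlgebra.of k i, a⁆ = 0) :
    a = CLie.freeCoeff k i a • FreeLieAlgebra.of k i := by
  obtain ⟨q, hq⟩ := exists_aeval_of_commute i (toAssoc k n a) (by
    have := congrArg (toAssoc k n) h
    rw [LieHom.map_lie, LieRing.of_associative_ring_bracket, map_zero, sub_eq_zero] at this
    simpa [toAssoc] using this)
  let ψ : FreeAlgebra k (Fin n) →ₐ[k] Polynomial k :=
    FreeAlgebra.lift k (fun j => if j = i then Polynomial.X else 0)
  have hψ : ∀ {e : ℕ} {b : FreeLieAlgebra k (Fin n)}, b ∈ lieHomog k n e →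
      ψ (toAssoc k n b) = CLie.freeCoeff k i b • Polynomial.X := by
    intro e b hb
    induction hb using Submodule.span_induction with
    | mem x hx =>
      cases hx with
      | gen j => by_cases hj : j = i <;> simp [ψ, toAssoc, CLie.freeCoeff_of, hj]
      | brk _ _ =>
        rw [CLie.freeCoeff_lie, LieHom.map_lie, LieRing.of_associative_ring_bracket, map_sub,
          map_mul, map_mul, mul_comm, sub_self, zero_smul]
    | zero => simp
    | add u v _ _ h1 h2 => rw [map_add, map_add, map_add, h1, h2, add_smul]
    | smul c u _ h1 => rw [map_smul, map_smul, map_smul, h1, smul_assoc]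
  have hq2 : q = CLie.freeCoeff k i a • Polynomial.X := by
    rw [← hψ ha, hq, ← Polynomial.aeval_algHom_apply]
    simp [ψ]
  have h0 : toAssoc k n a = toAssoc k n (CLie.freeCoeff k i a • FreeLieAlgebra.of k i) := by
    rw [hq, hq2]
    simp [toAssoc]
  by_cases hd : d = 1
  · subst hd
    rw [← sub_eq_zero]
    refine toAssoc_injective (sub_mem ha (Submodule.smul_mem _ _ (IsLieWord.gen i).mem)) ?_
    rw [map_sub, h0, sub_self]
  · rw [CLie.freeCoeff_eq_zero i hd ha, zero_smul, map_zero] at h0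
    rw [CLie.freeCoeff_eq_zero i hd ha, zero_smul]
    exact toAssoc_injective ha h0

end Free

/-! ### Tangential derivations -/

section Tangential

variable {k : Type*} [Field k] {n m : ℕ}

open CLie

variable (k n) in
/-- The space of tangential derivations: derivations `u` of the completed free Lie algebra such
that for some `a_1, …, a_n` one has `u(x_i) = ⁅x_i, a_i⁆` for all `i`. -/
def dert : Submodule k (LieDerivation k (CLie k n) (CLie k n)) where
  carrier := {u | ∃ a : Fin n → CLie k n, ∀ i, u (X k i) = ⁅X k i, a i⁆}
  zero_mem' := ⟨0, fun i => by simp⟩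
  add_mem' := by
    rintro u v ⟨a, ha⟩ ⟨b, hb⟩
    exact ⟨a + b, fun i => by simp [ha, hb]⟩
  smul_mem' := by
    rintro t u ⟨a, ha⟩
    exact ⟨t • a, fun i => by simp [ha]⟩

variable (k n) in
/-- The space of `n`-tuples `(a_1, …, a_n)` of elements of the completed free Lie algebra with
`p_i(a_i) = 0` for all `i`. -/
def normTuple : Submodule k (Fin n → CLie k n) where
  carrier := {a | ∀ i, proj k i (a i) = 0}
  zero_mem' := fun i => by simp
  add_mem' ha hb := fun i => by simp [ha i, hb i]
  smul_mem' t a ha := fun i => by simp [ha i]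

/-- The derivation of the completed free Lie algebra with `x_i ↦ ⁅x_i, a_i⁆`. -/
def derOfTuple (a : Fin n → CLie k n) : LieDerivation k (CLie k n) (CLie k n) where
  toFun b := CLie.mk (fun d => ∑ p ∈ Finset.HasAntidiagonal.antidiagonal d,
      freeDer (fun i => ⁅FreeLieAlgebra.of k i, (a i).comp p.1⁆) (b.comp p.2)) fun d =>
    Submodule.sum_mem _ fun p hp => by
      rw [← Finset.HasAntidiagonal.mem_antidiagonal.1 hp]
      refine freeDer_mem _ (fun i => ?_) (b.comp_mem _)
      rw [add_comm]
      exact lie_mem_lieHomog (IsLieWord.gen i).mem ((a i).comp_mem _)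
  map_add' b c := CLie.ext fun d => by
    rw [comp_add, comp_mk, comp_mk, comp_mk]
    simp [Finset.sum_add_distrib]
  map_smul' t b := CLie.ext fun d => by
    rw [RingHom.id_apply, comp_smul, comp_mk, comp_mk]
    simp [Finset.smul_sum]
  leibniz' b c := by
    refine CLie.ext fun d => ?_
    let D : ℕ → FreeLieAlgebra k (Fin n) →ₗ[k] FreeLieAlgebra k (Fin n) := fun e =>
      freeDer (fun i => ⁅FreeLieAlgebra.of k i, (a i).comp e⁆)
    have hD : ∀ e p q, D e ⁅b.comp p, c.comp q⁆ =
        ⁅b.comp p, D e (c.comp q)⁆ - ⁅c.comp q, D e (b.comp p)⁆ := fun e p q =>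
      freeDer_lie _ (b.comp_mem p) (c.comp_mem q)
    change ∑ p ∈ Finset.HasAntidiagonal.antidiagonal d, D p.1 (⁅b, c⁆.comp p.2) =
      ∑ p ∈ Finset.HasAntidiagonal.antidiagonal d,
        ⁅b.comp p.1, ∑ q ∈ Finset.HasAntidiagonal.antidiagonal p.2, D q.1 (c.comp q.2)⁆ -
      ∑ p ∈ Finset.HasAntidiagonal.antidiagonal d,
        ⁅c.comp p.1, ∑ q ∈ Finset.HasAntidiagonal.antidiagonal p.2, D q.1 (b.comp q.2)⁆
    simp only [comp_lie, map_sum, lie_sum, hD, Finset.sum_sub_distrib]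
    congr 1
    · rw [sum_triple (fun e p q => ⁅b.comp p, D e (c.comp q)⁆),
        sum_triple (fun p e q => ⁅b.comp p, D e (c.comp q)⁆)]
      exact Finset.sum_congr rfl fun p _ => sum_swap (fun i j => ⁅b.comp j, D i (c.comp p.2)⁆) _
    · rw [Finset.sum_congr rfl fun p _ =>
          sum_swap (fun i j => ⁅c.comp j, D p.1 (b.comp i)⁆) p.2,
        sum_triple (fun e q p => ⁅c.comp q, D e (b.comp p)⁆),
        sum_triple (fun q e p => ⁅c.comp q, D e (b.comp p)⁆)]
      exact Finset.sum_congr rfl fun p _ => sum_swap (fun i j => ⁅c.comp j, D i (b.comp p.2)⁆) _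

theorem derOfTuple_X (a : Fin n → CLie k n) (i : Fin n) :
    derOfTuple a (X k i) = ⁅X k i, a i⁆ := by
  refine CLie.ext fun d => ?_
  change ∑ p ∈ Finset.HasAntidiagonal.antidiagonal d,
      freeDer (fun i => ⁅FreeLieAlgebra.of k i, (a i).comp p.1⁆) ((X k i).comp p.2) =
    ∑ p ∈ Finset.HasAntidiagonal.antidiagonal d, ⁅(X k i).comp p.1, (a i).comp p.2⁆
  rw [sum_swap (fun p q => ⁅(X k i).comp p, (a i).comp q⁆)]
  refine Finset.sum_congr rfl fun p _ => ?_
  rw [comp_X]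
  split_ifs
  · rw [freeDer_of]
  · simp

variable [CharZero k]

/-- The centralizer of `x_i` in the completed free Lie algebra is `k x_i`. -/
theorem eq_zero_of_lie_X_eq_zero (i : Fin n) {a : CLie k n} (h : ⁅X k i, a⁆ = 0)
    (hp : proj k i a = 0) : a = 0 := by
  refine CLie.ext fun d => ?_
  have h1 : ⁅FreeLieAlgebra.of k i, a.comp d⁆ = 0 := by rw [← comp_X_lie, h, comp_zero]
  have h2 : freeCoeff k i (a.comp d) = 0 := by
    by_cases hd : d = 1
    · subst hd
      exact hp
    · exact freeCoeff_eq_zero i hd (a.comp_mem d)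
  rw [eq_smul_of_lie_eq_zero i (a.comp_mem d) h1, h2, zero_smul, comp_zero]

variable (k n) in
/-- The one-to-one correspondence between normalized `n`-tuples and tangential derivations:
`(a_1, …, a_n)` corresponds to the derivation `x_i ↦ ⁅x_i, a_i⁆`. -/
def tupleEquiv : normTuple k n ≃ₗ[k] dert k n :=
  LinearEquiv.ofBijective
    { toFun := fun a => ⟨derOfTuple a.1, a.1, derOfTuple_X a.1⟩
      map_add' := fun a b => Subtype.ext <| derivation_ext fun i => by simp [derOfTuple_X]
      map_smul' := fun t a => Subtype.ext <| derivation_ext fun i => by simp [derOfTuple_X] } <| by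
    constructor
    · rw [← LinearMap.ker_eq_bot, LinearMap.ker_eq_bot']
      intro a ha
      have ha' : derOfTuple a.1 = 0 := congrArg Subtype.val ha
      refine Subtype.ext (funext fun i => eq_zero_of_lie_X_eq_zero i ?_ (a.2 i))
      rw [← derOfTuple_X, ha']
      rfl
    · rintro ⟨u, a, ha⟩
      refine ⟨⟨fun i => a i - proj k i (a i) • X k i, fun i => ?_⟩, ?_⟩
      · simp [proj_X]
      · refine Subtype.ext (derivation_ext fun i => ?_)
        change derOfTuple _ (X k i) = u (X k i)
        rw [derOfTuple_X, ha i]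
        simp

theorem tupleEquiv_X (a : normTuple k n) (i : Fin n) :
    (tupleEquiv k n a).1 (X k i) = ⁅X k i, a.1 i⁆ := derOfTuple_X a.1 i

end Tangential

/-! ### Simplicial and coproduct maps, the differential and its cohomology -/

section Differential

variable {k : Type*} [Field k] {l m n : ℕ}

open CLie

variable (k) in
/-- For a partially defined map `φ : {1, …, m} ⇀ {1, …, n}`, the linear form
`∑_{φ(j) = i} x_j`. -/
def fiberSum (φ : Fin m → Option (Fin n)) (i : Fin n) : lieHomog k m 1 :=
  ⟨∑ j with φ j = some i, FreeLieAlgebra.of k j,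
    Submodule.sum_mem _ fun j _ => (IsLieWord.gen j).mem⟩

/-- The component `b` of a tuple is carried by the partial map `φ` to `b(y_1, …, y_n)` where
`y_i` is the sum of the generators `x_j` with `φ(j) = i`. -/
def substFiber (φ : Fin m → Option (Fin n)) : CLie k n →ₗ[k] CLie k m := subst (fiberSum k φ)

theorem proj_substFiber (φ : Fin m → Option (Fin n)) (b : CLie k n) (j : Fin m) :
    proj k j (substFiber φ b) = ∑ i, if φ j = some i then proj k i b else 0 := by
  rw [proj_apply, substFiber, comp_subst]
  conv_lhs => rw [lieHomog_one (b.comp_mem 1)]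
  simp only [map_sum, map_smul, FreeLieAlgebra.lift_of_apply, fiberSum, freeCoeff_of, smul_eq_mul]
  refine Finset.sum_congr rfl fun i _ => ?_
  rw [Finset.sum_ite_eq']
  simp [proj_apply]

/-- The map on normalized tuples induced by a partially defined map
`φ : {1, …, m} ⇀ {1, …, n}`: the `j`-th component of the image of `(a_1, …, a_n)` is
`a_{φ(j)}(y_1, …, y_n)` with `y_i = ∑_{φ(l) = i} x_l`, and `0` where `φ(j)` is not defined. -/
def tuplePull (φ : Fin m → Option (Fin n)) : normTuple k n →ₗ[k] normTuple k m where
  toFun a := ⟨fun j => (φ j).elim 0 fun i => substFiber φ (a.1 i), fun j => by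
    cases h : φ j with
    | none => simp [h]
    | some i =>
      have hi := a.2 i
      simp [proj_substFiber, h, hi]⟩
  map_add' a b := by
    ext1
    funext j
    cases h : φ j <;> simp [h]
  map_smul' t a := by
    ext1
    funext j
    cases h : φ j <;> simp [h]

theorem tuplePull_apply (φ : Fin m → Option (Fin n)) (a : normTuple k n) (j : Fin m) :
    (tuplePull φ a).1 j = (φ j).elim 0 fun i => substFiber φ (a.1 i) := rfl

theorem tuplePull_tuplePull (φ : Fin m → Option (Fin n)) (ψ : Fin l → Option (Fin m))
    (a : normTuple k n) :
    tuplePull ψ (tuplePull φ a) = tuplePull (fun j => (ψ j).bind φ) a := by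
  have hs : ∀ b : CLie k n,
      substFiber ψ (substFiber φ b) = substFiber (fun j => (ψ j).bind φ) b := by
    intro b
    refine CLie.ext fun d => ?_
    simp only [substFiber, comp_subst]
    rw [← LieHom.comp_apply]
    congr 1
    refine FreeLieAlgebra.hom_ext fun i => ?_
    simp only [LieHom.comp_apply, FreeLieAlgebra.lift_of_apply, fiberSum, map_sum]
    simp only [Finset.sum_filter]
    simp only [Finset.ite_sum_zero]
    rw [Finset.sum_comm]
    refine Finset.sum_congr rfl fun q _ => ?_
    cases ψ q with
    | none => simp
    | some r =>
      rw [Finset.sum_eq_single r]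
      · simp
      · intro j _ hj
        simp [Ne.symm hj]
      · simp
  refine Subtype.ext (funext fun j => ?_)
  simp only [tuplePull_apply]
  cases h : ψ j with
  | none => simp
  | some i =>
    simp only [Option.elim_some, Option.bind_some]
    cases h2 : φ i with
    | none => simp
    | some r => simp [hs]

/-- `{1, …, n+1} ⇀ {1, …, n}`, not defined at `1`, and `j + 1 ↦ j`. -/
def dropFirst (n : ℕ) : Fin (n + 1) → Option (Fin n) := Fin.cases none some

/-- `{1, …, n+1} ⇀ {1, …, n}`, not defined at `n + 1`, and `j ↦ j` for `j ≤ n`. -/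
def dropLast (n : ℕ) : Fin (n + 1) → Option (Fin n) := Fin.lastCases none some

/-- `{1, …, n+1} → {1, …, n}`, the monotone surjection which identifies `i` with `i + 1`. -/
def merge {n : ℕ} (i : Fin n) : Fin (n + 1) → Option (Fin n) := fun j => some (i.predAbove j)

variable [CharZero k]

/-- The map on tangential derivations induced by a partially defined map. -/
def dertPull (φ : Fin m → Option (Fin n)) : dert k n →ₗ[k] dert k m :=
  (tupleEquiv k m).toLinearMap ∘ₗ tuplePull φ ∘ₗ (tupleEquiv k n).symm.toLinearMap

/-- The simplicial map `u ↦ u^{2,3,…,n+1} = (0, a_1(x_2, …, x_{n+1}), …, a_n(x_2, …, x_{n+1}))`. -/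
def simplicialFirst (n : ℕ) : dert k n →ₗ[k] dert k (n + 1) := dertPull (dropFirst n)

/-- The simplicial map `u ↦ u^{1,2,…,n} = (a_1, …, a_n, 0)`. -/
def simplicialLast (n : ℕ) : dert k n →ₗ[k] dert k (n + 1) := dertPull (dropLast n)

/-- The coproduct map `u ↦ u^{1,…,i(i+1),…,n+1}`: in the components
`(a_1, …, a_i, a_i, …, a_n)` the elements `x_1, …, x_i + x_{i+1}, …, x_{n+1}` are substituted for
the generators. -/
def coproduct {n : ℕ} (i : Fin n) : dert k n →ₗ[k] dert k (n + 1) := dertPull (merge i)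

variable (k) in
/-- The differential `d : dert_n → dert_{n+1}`,
`d u = u^{2,…,n+1} - u^{12,…,n+1} + … + (-1)^n u^{1,…,n(n+1)} + (-1)^{n+1} u^{1,…,n}`. -/
def d (n : ℕ) : dert k n →ₗ[k] dert k (n + 1) :=
  simplicialFirst n + ∑ i : Fin n, (-1 : k) ^ (i.1 + 1) • coproduct i +
    (-1 : k) ^ (n + 1) • simplicialLast n

/-- Uniform description of `dropFirst`, `merge` and `dropLast`, used for `d ∘ d = 0` only. -/
def coface (n i : ℕ) (j : Fin (n + 1)) : Option (Fin n) :=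
  if j.1 < i then (if h : j.1 < n then some ⟨j.1, h⟩ else none)
  else (if h : 1 ≤ j.1 then some ⟨j.1 - 1, by omega⟩ else none)

theorem coface_first (n : ℕ) : coface n 0 = dropFirst n := by
  funext j
  refine Fin.cases ?_ (fun j => ?_) j <;> simp [coface, dropFirst]

theorem coface_last (n : ℕ) : coface n (n + 1) = dropLast n := by
  funext j
  refine Fin.lastCases ?_ (fun j => ?_) j
  · simp [coface, dropLast]
  · simp only [coface, dropLast, Fin.lastCases_castSucc, Fin.val_castSucc]
    rw [if_pos (by omega), dif_pos j.2]

theorem coface_merge {n : ℕ} (i : Fin n) : coface n (i.1 + 1) = merge i := by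
  funext j
  simp only [coface, merge, Fin.predAbove, Fin.lt_def, Fin.val_castSucc]
  split_ifs <;> first | omega | rfl

theorem d_eq_sum (n : ℕ) :
    d k n = ∑ i ∈ Finset.range (n + 2), (-1 : k) ^ i • dertPull (coface n i) := by
  rw [Finset.sum_range_succ, Finset.sum_range_succ', coface_first, coface_last, d,
    ← Fin.sum_univ_eq_sum_range (fun i => (-1 : k) ^ (i + 1) • dertPull (coface n (i + 1)))]
  simp only [coface_merge, pow_zero, one_smul, simplicialFirst, simplicialLast, coproduct]
  rw [add_comm (dertPull (dropFirst n))]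

theorem dertPull_dertPull (φ : Fin m → Option (Fin n)) (ψ : Fin l → Option (Fin m))
    (u : dert k n) :
    dertPull ψ (dertPull φ u) = dertPull (fun j => (ψ j).bind φ) u := by
  simp [dertPull, tuplePull_tuplePull]

theorem coface_coface (n : ℕ) {i j : ℕ} (hij : i ≤ j) (x : Fin (n + 2)) :
    (coface (n + 1) i x).bind (coface n j) = (coface (n + 1) (j + 1) x).bind (coface n i) := by
  unfold coface
  split_ifs <;> simp only [Option.bind_some, Option.bind_none] <;> split_ifs <;>
    first | rfl | (exfalso; omega)

/-- `d` is a differential: `d ∘ d = 0`. -/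
theorem d_comp_d (n : ℕ) : d k (n + 1) ∘ₗ d k n = 0 := by
  ext1 u
  simp only [LinearMap.comp_apply, LinearMap.zero_apply, d_eq_sum, LinearMap.sum_apply,
    LinearMap.smul_apply, map_sum, map_smul, dertPull_dertPull]
  rw [Finset.sum_congr rfl fun j _ => Finset.smul_sum, ← Finset.sum_product']
  refine Finset.sum_involution
    (fun p _ => if p.2 ≤ p.1 then (p.2, p.1 + 1) else (p.2 - 1, p.1)) ?_ ?_ ?_ ?_
  · rintro ⟨j, i⟩ _
    by_cases h : i ≤ j
    · simp only [h, if_true]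
      rw [funext fun x => coface_coface n h x, smul_smul, smul_smul, ← add_smul, pow_succ]
      ring_nf
      simp
    · obtain ⟨i, rfl⟩ : ∃ s, i = s + 1 := ⟨i - 1, by omega⟩
      simp only [h, if_false, Nat.add_sub_cancel]
      rw [funext fun x => coface_coface n (show j ≤ i by omega) x, smul_smul, smul_smul,
        ← add_smul, pow_succ]
      ring_nf
      simp
  · rintro ⟨j, i⟩ _ _ he
    split_ifs at he <;> simp only [Prod.mk.injEq] at he <;> omega
  · rintro ⟨j, i⟩ hp
    simp only [Finset.mem_product, Finset.mem_range] at hp ⊢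
    split_ifs <;> simp only <;> omega
  · rintro ⟨j, i⟩ _
    by_cases h : i ≤ j
    · have h1 : ¬ j + 1 ≤ i := by omega
      simp [h, h1]
    · have h1 : j ≤ i - 1 := by omega
      have h2 : i - 1 + 1 = i := by omega
      simp [h, h1, h2]

/-- The coboundaries: the image of `d : dert_{n-1} → dert_n` (zero for `n = 0`). -/
def coboundaries (k : Type*) [Field k] [CharZero k] : (n : ℕ) → Submodule k (dert k n)
  | 0 => ⊥
  | n + 1 => LinearMap.range (d k n)

/-- The cohomology
`H^n(dert, d) = ker (d : dert_n → dert_{n+1}) / im (d : dert_{n-1} → dert_n)`. -/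
abbrev cohomology (k : Type*) [Field k] [CharZero k] (n : ℕ) : Type _ :=
  LinearMap.ker (d k n) ⧸ (coboundaries k n).submoduleOf (LinearMap.ker (d k n))

/-! ### The elements `r`, `t` and the cocycle `(0, [z, x], 0)` -/

variable (k)

/-- `r = (y, 0) ∈ dert_2`, where `x = X k 0` and `y = X k 1`. -/
def r : dert k 2 := tupleEquiv k 2 ⟨![X k 1, 0], fun i => by fin_cases i <;> simp [proj_X]⟩

/-- `t = (y, x) ∈ dert_2`. -/
def t : dert k 2 := tupleEquiv k 2 ⟨![X k 1, X k 0], fun i => by fin_cases i <;> simp [proj_X]⟩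

/-- `(0, [z, x], 0) ∈ dert_3`, where `x = X k 0` and `z = X k 2`. -/
def zxElt : dert k 3 :=
  tupleEquiv k 3 ⟨![0, ⁅X k 2, X k 0⁆, 0], fun i => by
    fin_cases i
    exacts [map_zero _, proj_lie _ _ _, map_zero _]⟩

end Differential

end
end TangentialDer

/-! The proof turns tangential derivations into functions of words, where the differential becomes a
simplicial coboundary on chains of subsets.

Embed the free Lie algebra in the free associative algebra. A tuple `(u_1, …, u_n)` homogeneous of
degree `e` is recorded by the function sending a word `i w` of length `e + 1` to the coefficient of
`w` in `u_i`. The substitution along a partial map `φ` of letters becomes composition of words with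
`φ`, with value zero as soon as a letter is undefined (`tupleCoeff_freePull`), so `freeD` becomes
`wordD` (`tupleCoeff_freeD`).

Let `α` be the set of the `e + 1` places of a word. A word in `n` letters is a chain `S_1 ⊆ … ⊆
S_{n-1}` of subsets of `α`, and merging two letters drops one subset. After the contributions of `∅`
and of `α` are removed, what remains is the augmented cochain complex of the poset of proper
nonempty subsets. This poset is the barycentric subdivision of the boundary of a simplex, a sphere
of dimension `|α| - 2`, and `n` letters correspond to cochain degree `n - 2`. For two letters,
connectedness gives exactness when `|α| ≥ 3`; only degree `e = 1` is left, and it consists of the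
combinations of `r` and `t`. For three letters, `H^1` of the sphere vanishes unless `|α| = 3`, that
is `e = 2`, where the sphere is a hexagon and the alternating sum around it (`altCoeff`) is the only
obstruction. This functional kills coboundaries and takes the value 2 on `(0, [z, x], 0)`.

A primitive found on words is only associative. The Dynkin map brings it back to Lie elements: it
commutes with substitutions and multiplies Lie elements of degree `e` by `e`, which is invertible in
characteristic zero (`exists_freeD_eq`). -/

namespace TangentialDer

noncomputable section

open CLie

variable {k : Type*} [Field k] {n m : ℕ}

/-! ### Coefficients of words in the free associative algebra -/

/-- Left multiplication by the letter `i` on functions of words. The letter `none` stands for an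
undefined letter, at which every function in the image of `letterAct` vanishes. -/
def letterAct (i : Fin n) : Module.End k (List (Option (Fin n)) → k) where
  toFun h w := match w with
    | [] => 0
    | o :: w => if o = some i then h w else 0
  map_add' g h := by
    funext w
    rcases w with _ | ⟨o, w⟩
    · simp
    · by_cases ho : o = some i <;> simp [ho]
  map_smul' c h := by
    funext w
    rcases w with _ | ⟨o, w⟩
    · simp
    · by_cases ho : o = some i <;> simp [ho]

theorem letterAct_nil (i : Fin n) (h : List (Option (Fin n)) → k) : letterAct i h [] = 0 := rfl

theorem letterAct_cons (i : Fin n) (h : List (Option (Fin n)) → k) (o : Option (Fin n))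
    (w : List (Option (Fin n))) : letterAct i h (o :: w) = if o = some i then h w else 0 := rfl

/-- The coefficients of an element of the free associative algebra, as a function of words. -/
def wordCoeff : FreeAlgebra k (Fin n) →ₗ[k] (List (Option (Fin n)) → k) :=
  LinearMap.applyₗ (fun w : List (Option (Fin n)) => if w = [] then (1 : k) else 0) ∘ₗ
    (FreeAlgebra.lift k letterAct).toLinearMap

theorem wordCoeff_apply (b : FreeAlgebra k (Fin n)) :
    wordCoeff b = FreeAlgebra.lift k letterAct b (fun w => if w = [] then (1 : k) else 0) := rfl

theorem wordCoeff_one (w : List (Option (Fin n))) :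
    wordCoeff (1 : FreeAlgebra k (Fin n)) w = if w = [] then 1 else 0 := by
  simp [wordCoeff_apply]

theorem wordCoeff_ι_mul (i : Fin n) (b : FreeAlgebra k (Fin n)) :
    wordCoeff (FreeAlgebra.ι k i * b) = letterAct i (wordCoeff b) := by
  simp [wordCoeff_apply, Module.End.mul_apply]

/-- This is the convention that lets the outer cofaces, which are undefined at one letter, be
treated like the merging ones. It holds because each letter operator only passes on words starting
with a defined letter, and the initial function is supported at the empty word. -/
theorem wordCoeff_of_none_mem (b : FreeAlgebra k (Fin n)) {w : List (Option (Fin n))}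
    (hw : none ∈ w) : wordCoeff b w = 0 := by
  have key : ∀ (b : FreeAlgebra k (Fin n)) (h : List (Option (Fin n)) → k),
      (∀ w, none ∈ w → h w = 0) → ∀ w, none ∈ w → FreeAlgebra.lift k letterAct b h w = 0 := by
    intro b
    induction b using FreeAlgebra.induction with
    | grade0 r => intro h hh w hw; simp [hh w hw, Algebra.algebraMap_eq_smul_one]
    | grade1 i =>
      intro h hh w hw
      rw [FreeAlgebra.lift_ι_apply]
      rcases w with _ | ⟨o, w⟩
      · rfl
      · rw [letterAct_cons]
        split_ifs with ho
        · subst ho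
          exact hh w (by simpa using hw)
        · rfl
    | mul a b ha hb =>
      intro h hh w hw
      rw [map_mul, Module.End.mul_apply]
      exact ha _ (hb h hh) w hw
    | add a b ha hb => intro h hh w hw; simp [ha h hh w hw, hb h hh w hw]
  exact key b _ (fun w hw => if_neg (List.ne_nil_of_mem hw)) w hw

/-- The product of the letters of a word. -/
def wordProd (k : Type*) [Field k] {n : ℕ} (w : List (Fin n)) : FreeAlgebra k (Fin n) :=
  (w.map (FreeAlgebra.ι k)).prod

theorem wordCoeff_wordProd (w v : List (Fin n)) :
    wordCoeff (wordProd k w) (v.map some) = if v = w then 1 else 0 := by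
  induction w generalizing v with
  | nil => simp [wordProd, wordCoeff_one]
  | cons i w ih =>
    have : wordProd k (i :: w) = FreeAlgebra.ι k i * wordProd k w := by simp [wordProd]
    rw [this, wordCoeff_ι_mul]
    rcases v with _ | ⟨j, v⟩
    · simp [letterAct_nil]
    · rw [List.map_cons, letterAct_cons, ih]
      by_cases h : j = i <;> simp [h]

variable (k n) in
/-- The span of the words of length `d`. -/
def assocHomog (d : ℕ) : Submodule k (FreeAlgebra k (Fin n)) :=
  Submodule.span k {b | ∃ w : List (Fin n), w.length = d ∧ b = wordProd k w}

theorem wordProd_mem_assocHomog (w : List (Fin n)) : wordProd k w ∈ assocHomog k n w.length :=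
  Submodule.subset_span ⟨w, rfl, rfl⟩

theorem mul_mem_assocHomog {p q : ℕ} {a b : FreeAlgebra k (Fin n)} (ha : a ∈ assocHomog k n p)
    (hb : b ∈ assocHomog k n q) : a * b ∈ assocHomog k n (p + q) := by
  refine (Submodule.mul_le (P := assocHomog k n (p + q))).1 ?_ a ha b hb
  rw [assocHomog, assocHomog, Submodule.span_mul_span, Submodule.span_le]
  rintro _ ⟨_, ⟨w, rfl, rfl⟩, _, ⟨v, rfl, rfl⟩, rfl⟩
  exact Submodule.subset_span ⟨w ++ v, by simp, by simp [wordProd]⟩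

section

attribute [local instance 100] LieRing.ofAssociativeRing

theorem toAssoc_mem_assocHomog {d : ℕ} {a : FreeLieAlgebra k (Fin n)} (ha : a ∈ lieHomog k n d) :
    toAssoc k n a ∈ assocHomog k n d := by
  induction ha using Submodule.span_induction with
  | mem x hx =>
    induction hx with
    | gen i => exact Submodule.subset_span ⟨[i], rfl, by simp [toAssoc, wordProd]⟩
    | @brk p q u v _ _ h1 h2 =>
      rw [LieHom.map_lie, LieRing.of_associative_ring_bracket]
      refine sub_mem (mul_mem_assocHomog h1 h2) ?_
      rw [add_comm]
      exact mul_mem_assocHomog h2 h1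
  | zero => simp
  | add u v _ _ h1 h2 => rw [map_add]; exact add_mem h1 h2
  | smul c u _ h1 => rw [map_smul]; exact Submodule.smul_mem _ _ h1

end

theorem sum_wordCoeff_smul_wordProd {d : ℕ} {b : FreeAlgebra k (Fin n)}
    (hb : b ∈ assocHomog k n d) :
    b = ∑ w : Fin d → Fin n,
      wordCoeff b (List.ofFn fun p => some (w p)) • wordProd k (List.ofFn w) := by
  induction hb using Submodule.span_induction with
  | mem x hx =>
    obtain ⟨v, rfl, rfl⟩ := hx
    rw [Finset.sum_eq_single v.get]
    · have : (List.ofFn fun p => some (v.get p)) = v.map some := by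
        conv_rhs => rw [← List.ofFn_get v, List.map_ofFn]
        rfl
      rw [this, wordCoeff_wordProd, if_pos rfl, one_smul, List.ofFn_get]
    · intro w _ hw
      have : (List.ofFn fun p => some (w p)) = (List.ofFn w).map some := by
        rw [List.map_ofFn]
        rfl
      rw [this, wordCoeff_wordProd, if_neg, zero_smul]
      intro h
      apply hw
      apply List.ofFn_injective
      rw [h, List.ofFn_get]
    · simp
  | zero => simp
  | add u v _ _ h1 h2 =>
    conv_lhs => rw [h1, h2]
    simp [add_smul, Finset.sum_add_distrib]
  | smul c u _ h1 =>
    conv_lhs => rw [h1]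
    simp [Finset.smul_sum, mul_smul]

theorem eq_of_wordCoeff_eq {d : ℕ} {a b : FreeAlgebra k (Fin n)} (ha : a ∈ assocHomog k n d)
    (hb : b ∈ assocHomog k n d)
    (h : ∀ w : Fin d → Fin n, wordCoeff a (List.ofFn fun p => some (w p)) =
      wordCoeff b (List.ofFn fun p => some (w p))) : a = b := by
  rw [sum_wordCoeff_smul_wordProd ha, sum_wordCoeff_smul_wordProd hb]
  exact Finset.sum_congr rfl fun w _ => by rw [h]

/-! ### Substitution along a partial map of the letters -/

/-- The substitution `x_i ↦ ∑_{φ(j) = i} x_j` on free associative algebras. -/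
def substAssoc (φ : Fin m → Option (Fin n)) : FreeAlgebra k (Fin n) →ₐ[k] FreeAlgebra k (Fin m) :=
  FreeAlgebra.lift k fun i => ∑ j with φ j = some i, FreeAlgebra.ι k j

/-- The substitution `x_i ↦ ∑_{φ(j) = i} x_j` on free Lie algebras. -/
def substLie (φ : Fin m → Option (Fin n)) :
    FreeLieAlgebra k (Fin n) →ₗ⁅k⁆ FreeLieAlgebra k (Fin m) :=
  FreeLieAlgebra.lift k fun i => (fiberSum k φ i : FreeLieAlgebra k (Fin m))

theorem substLie_of (φ : Fin m → Option (Fin n)) (i : Fin n) :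
    substLie φ (FreeLieAlgebra.of k i) = ∑ j with φ j = some i, FreeLieAlgebra.of k j := by
  rw [substLie, FreeLieAlgebra.lift_of_apply, fiberSum]

theorem comp_substFiber (φ : Fin m → Option (Fin n)) (a : CLie k n) (d : ℕ) :
    (substFiber φ a).comp d = substLie φ (a.comp d) := rfl

section

attribute [local instance 100] LieRing.ofAssociativeRing

theorem toAssoc_substLie (φ : Fin m → Option (Fin n)) (a : FreeLieAlgebra k (Fin n)) :
    toAssoc k m (substLie φ a) = substAssoc φ (toAssoc k n a) := by
  have : (toAssoc k m).comp (substLie φ) = (substAssoc φ).toLieHom.comp (toAssoc k n) := by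
    refine FreeLieAlgebra.hom_ext fun i => ?_
    simp [toAssoc, substLie_of, substAssoc]
  exact LieHom.congr_fun this a

end

/-- When `∑_{φ(j) = i} x_j` is substituted for each `x_i` and the product is expanded, the word `w`
arises exactly once from the word `φ(w)` and from no other. -/
theorem wordCoeff_substAssoc (φ : Fin m → Option (Fin n)) (b : FreeAlgebra k (Fin n))
    (w : List (Option (Fin m))) :
    wordCoeff (substAssoc φ b) w = wordCoeff b (w.map (·.bind φ)) := by
  -- The initial function must be arbitrary: for a product, the first factor acts on the output of
  -- the second.
  have key : ∀ (b : FreeAlgebra k (Fin n)) (h : List (Option (Fin n)) → k)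
      (w : List (Option (Fin m))),
      FreeAlgebra.lift k letterAct (substAssoc φ b) (fun w => h (w.map (·.bind φ))) w =
        FreeAlgebra.lift k letterAct b h (w.map (·.bind φ)) := by
    intro b
    induction b using FreeAlgebra.induction with
    | grade0 r => intro h w; simp [Algebra.algebraMap_eq_smul_one]
    | grade1 i =>
      intro h w
      simp only [substAssoc, FreeAlgebra.lift_ι_apply, map_sum, LinearMap.sum_apply,
        Finset.sum_apply]
      rcases w with _ | ⟨o, w⟩
      · simp [letterAct_nil]
      · simp only [List.map_cons, letterAct_cons]
        rcases o with _ | j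
        · simp
        · simp [Finset.sum_ite_eq, Finset.mem_filter]
    | mul a b ha hb =>
      intro h w
      rw [map_mul, map_mul, map_mul, Module.End.mul_apply, Module.End.mul_apply, ← ha]
      exact congrFun (congrArg _ (funext fun v => hb h v)) w
    | add a b ha hb => intro h w; simp [ha, hb]
  rw [wordCoeff_apply, wordCoeff_apply, ← key]
  simp

theorem substAssoc_mem (φ : Fin m → Option (Fin n)) {d : ℕ} {b : FreeAlgebra k (Fin n)}
    (hb : b ∈ assocHomog k n d) : substAssoc φ b ∈ assocHomog k m d := by
  induction hb using Submodule.span_induction with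
  | mem x hx =>
    obtain ⟨v, rfl, rfl⟩ := hx
    induction v with
    | nil => simpa [wordProd] using wordProd_mem_assocHomog (k := k) (n := m) []
    | cons i v ih =>
      have : wordProd k (i :: v) = FreeAlgebra.ι k i * wordProd k v := by simp [wordProd]
      rw [this, map_mul, List.length_cons, add_comm]
      refine mul_mem_assocHomog ?_ ih
      rw [substAssoc, FreeAlgebra.lift_ι_apply]
      refine Submodule.sum_mem _ fun j _ => ?_
      exact Submodule.subset_span ⟨[j], rfl, by simp [wordProd]⟩
  | zero => simp
  | add u v _ _ h1 h2 => rw [map_add]; exact add_mem h1 h2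
  | smul c u _ h1 => rw [map_smul]; exact Submodule.smul_mem _ _ h1

/-! ### The Dynkin map -/

/-- The Dynkin map from the free associative algebra to the free Lie algebra, sending a word
`x_1 x_2 … x_d` to `⁅x_1, ⁅x_2, …, x_d⁆⁆`. -/
def dynkin : FreeAlgebra k (Fin n) →ₗ[k] FreeLieAlgebra k (Fin n) :=
  LinearMap.fst k _ _ ∘ₗ LinearMap.applyₗ ((0, 1) : FreeLieAlgebra k (Fin n) × k) ∘ₗ
    (FreeAlgebra.lift k (genAct (FreeLieAlgebra.of k))).toLinearMap

theorem dynkin_apply (b : FreeAlgebra k (Fin n)) :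
    dynkin b = (FreeAlgebra.lift k (genAct (FreeLieAlgebra.of k)) b (0, 1)).1 := rfl

section

attribute [local instance 100] LieRing.ofAssociativeRing

/-- Dynkin–Specht–Wever: restricted to Lie elements, the action defining the Dynkin map is the one
defining the derivation `x_i ↦ x_i`, which is the Euler derivation. -/
theorem dynkin_toAssoc {d : ℕ} {a : FreeLieAlgebra k (Fin n)} (ha : a ∈ lieHomog k n d) :
    dynkin (toAssoc k n a) = (d : k) • a := by
  rw [← freeDer_euler ha]
  have : FreeLieAlgebra.lift k (genAct (FreeLieAlgebra.of (X := Fin n) k)) =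
      ((FreeAlgebra.lift k (genAct (FreeLieAlgebra.of k))).toLieHom).comp (toAssoc k n) := by
    refine FreeLieAlgebra.hom_ext fun i => ?_
    simp [toAssoc]
  change _ = (FreeLieAlgebra.lift k (genAct (FreeLieAlgebra.of k)) a (0, 1)).1
  rw [this]
  rfl

end

/-- The right-normed bracket is linear in each letter, so it does not matter whether sums of letters
are substituted before or after bracketing. This makes the Dynkin map compatible with every term of
the differential. -/
theorem dynkin_substAssoc (φ : Fin m → Option (Fin n)) (b : FreeAlgebra k (Fin n)) :
    dynkin (substAssoc φ b) = substLie φ (dynkin b) := by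
  have key : ∀ (b : FreeAlgebra k (Fin n)) (z : FreeLieAlgebra k (Fin n) × k),
      FreeAlgebra.lift k (genAct (FreeLieAlgebra.of k)) (substAssoc φ b) (substLie φ z.1, z.2) =
        (substLie φ (FreeAlgebra.lift k (genAct (FreeLieAlgebra.of k)) b z).1,
          (FreeAlgebra.lift k (genAct (FreeLieAlgebra.of k)) b z).2) := by
    intro b
    induction b using FreeAlgebra.induction with
    | grade0 r => intro z; simp [Algebra.algebraMap_eq_smul_one]
    | grade1 i =>
      intro z
      simp only [substAssoc, FreeAlgebra.lift_ι_apply, map_sum, LinearMap.sum_apply]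
      ext
      · simp [genAct, substLie_of, Prod.fst_sum, Finset.sum_add_distrib, sum_lie,
          Finset.smul_sum]
      · simp [genAct, Prod.snd_sum]
    | mul a b ha hb =>
      intro z
      rw [map_mul, map_mul, map_mul, Module.End.mul_apply, Module.End.mul_apply, hb, ha]
    | add a b ha hb => intro z; simp [ha, hb]
  have := key b (0, 1)
  rw [map_zero] at this
  rw [dynkin_apply, this]
  rfl

theorem dynkin_mem {d : ℕ} {b : FreeAlgebra k (Fin n)} (hb : b ∈ assocHomog k n d) :
    dynkin b ∈ lieHomog k n d := by
  induction hb using Submodule.span_induction with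
  | mem x hx =>
    obtain ⟨v, rfl, rfl⟩ := hx
    induction v with
    | nil => simp [wordProd, dynkin_apply]
    | cons i v ih =>
      have h : dynkin (wordProd k (i :: v)) = ⁅FreeLieAlgebra.of k i, dynkin (wordProd k v)⁆ +
          (FreeAlgebra.lift k (genAct (FreeLieAlgebra.of k)) (wordProd k v) (0, 1)).2 •
            FreeLieAlgebra.of k i := by
        simp [dynkin_apply, wordProd, Module.End.mul_apply, genAct]
      rw [h]
      refine add_mem ?_ ?_
      · rw [List.length_cons, add_comm]
        exact lie_mem_lieHomog (IsLieWord.gen i).mem ih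
      -- The scalar coordinate survives only for the empty word, since the action of any letter sets
      -- it to zero.
      · rcases v with _ | ⟨j, v⟩
        · exact Submodule.smul_mem _ _ (IsLieWord.gen i).mem
        · have : (FreeAlgebra.lift k (genAct (FreeLieAlgebra.of k)) (wordProd k (j :: v))
              (0, 1)).2 = 0 := by
            simp [wordProd, Module.End.mul_apply, genAct]
          rw [this, zero_smul]
          exact zero_mem _
  | zero => simp
  | add u v _ _ h1 h2 => rw [map_add]; exact add_mem h1 h2
  | smul c u _ h1 => rw [map_smul]; exact Submodule.smul_mem _ _ h1

theorem dynkin_ι (i : Fin n) : dynkin (FreeAlgebra.ι k i) = FreeLieAlgebra.of k i := by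
  simp [dynkin_apply, genAct]

/-! ### The differential on tuples of Lie elements and on functions of words -/

/-- The map on tuples of Lie elements induced by a partial map of the letters. -/
def freePull (φ : Fin m → Option (Fin n)) (u : Fin n → FreeLieAlgebra k (Fin n)) (j : Fin m) :
    FreeLieAlgebra k (Fin m) := (φ j).elim 0 fun i => substLie φ (u i)

/-- The differential on tuples of Lie elements. -/
def freeD (u : Fin n → FreeLieAlgebra k (Fin n)) (j : Fin (n + 1)) :
    FreeLieAlgebra k (Fin (n + 1)) :=
  ∑ i ∈ Finset.range (n + 2), (-1 : k) ^ i • freePull (coface n i) u j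

/-- The coefficients of a tuple `(u_1, …, u_n)`: at the word `i w` this is the coefficient of `w`
in `u_i`. -/
def tupleCoeff (u : Fin n → FreeLieAlgebra k (Fin n)) {d : ℕ} (w : Fin (d + 1) → Option (Fin n)) :
    k := (w 0).elim 0 fun i => wordCoeff (toAssoc k n (u i)) (List.ofFn fun p => w p.succ)

/-- The differential on functions of words. -/
def wordD {α : Type*} (g : (α → Option (Fin n)) → k) (w : α → Fin (n + 1)) : k :=
  ∑ i ∈ Finset.range (n + 2), (-1 : k) ^ i * g fun p => coface n i (w p)

theorem tupleCoeff_of_none (u : Fin n → FreeLieAlgebra k (Fin n)) {d : ℕ}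
    {w : Fin (d + 1) → Option (Fin n)} (hw : ∃ p, w p = none) : tupleCoeff u w = 0 := by
  obtain ⟨p, hp⟩ := hw
  rw [tupleCoeff]
  refine Fin.cases (fun h => by simp [h]) (fun p h => ?_) p hp
  rcases w 0 with _ | i
  · rfl
  · exact wordCoeff_of_none_mem _ (List.mem_ofFn.2 ⟨p, h⟩)

/-- The first letter is the index of the component and the others are read in the substituted
element, and `φ` acts on both in the same way. This is why index and word are joined into one word
of length `d + 1`. -/
theorem tupleCoeff_freePull (φ : Fin m → Option (Fin n)) (u : Fin n → FreeLieAlgebra k (Fin n))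
    {d : ℕ} (w : Fin (d + 1) → Fin m) :
    tupleCoeff (freePull φ u) (fun p => some (w p)) = tupleCoeff u fun p => φ (w p) := by
  simp only [tupleCoeff, freePull, Option.elim_some]
  rcases φ (w 0) with _ | i
  · simp
  · simp only [Option.elim_some, toAssoc_substLie, wordCoeff_substAssoc, List.map_ofFn]
    rfl

theorem tupleCoeff_freeD (u : Fin n → FreeLieAlgebra k (Fin n)) {d : ℕ}
    (w : Fin (d + 1) → Fin (n + 1)) :
    tupleCoeff (freeD u) (fun p => some (w p)) = wordD (tupleCoeff u) w := by
  rw [wordD, Finset.sum_congr rfl fun i _ => by rw [← tupleCoeff_freePull (coface n i)]]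
  simp [tupleCoeff, freeD, Finset.sum_apply]

/-- If the coefficients of a homogeneous tuple are the coboundary of a function of words, then the
tuple is a coboundary. -/
theorem exists_freeD_eq [CharZero k] {d : ℕ} (hd : d ≠ 0)
    {u : Fin (n + 1) → FreeLieAlgebra k (Fin (n + 1))} (hu : ∀ j, u j ∈ lieHomog k (n + 1) d)
    {g : (Fin (d + 1) → Option (Fin n)) → k} (hg : ∀ w, (∃ p, w p = none) → g w = 0)
    (h : ∀ w : Fin (d + 1) → Fin (n + 1), tupleCoeff u (fun p => some (w p)) = wordD g w)
    (hc : d = 1 → ∀ i, g (fun _ => some i) = 0) :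
    ∃ v : Fin n → FreeLieAlgebra k (Fin n), (∀ i, v i ∈ lieHomog k n d) ∧
      (∀ i, freeCoeff k i (v i) = 0) ∧ freeD v = u := by
  -- The associative elements whose coefficients are prescribed by `g`; in general they are not Lie
  -- elements.
  let b : Fin n → FreeAlgebra k (Fin n) := fun i => ∑ w : Fin d → Fin n,
    g (fun p => some ((Fin.cons i w : Fin (d + 1) → Fin n) p)) • wordProd k (List.ofFn w)
  have hb : ∀ i, b i ∈ assocHomog k n d := fun i => Submodule.sum_mem _ fun w _ =>
    Submodule.smul_mem _ _ (Submodule.subset_span ⟨_, List.length_ofFn, rfl⟩)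
  have hbc : ∀ w : Fin (d + 1) → Option (Fin n), (w 0).elim 0
      (fun i => wordCoeff (b i) (List.ofFn fun p => w p.succ)) = g w := by
    intro w
    by_cases hw : ∃ p, w p = none
    · rw [hg w hw]
      obtain ⟨p, hp⟩ := hw
      refine Fin.cases (fun h => by simp [h]) (fun p h => ?_) p hp
      rcases w 0 with _ | i
      · rfl
      · exact wordCoeff_of_none_mem _ (List.mem_ofFn.2 ⟨p, h⟩)
    · push Not at hw
      obtain ⟨v, rfl⟩ : ∃ v : Fin (d + 1) → Fin n, w = fun p => some (v p) := by
        choose v hv using fun p => Option.ne_none_iff_exists'.1 (hw p)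
        exact ⟨v, funext hv⟩
      have e : (List.ofFn fun p : Fin d => some (v p.succ)) =
          (List.ofFn fun p => v p.succ).map some := by
        rw [List.map_ofFn]
        rfl
      simp only [Option.elim_some, b, map_sum, map_smul, Finset.sum_apply, Pi.smul_apply, e,
        wordCoeff_wordProd, smul_eq_mul, mul_ite, mul_one, mul_zero]
      rw [Finset.sum_eq_single (fun p => v p.succ)]
      · rw [if_pos rfl]
        congr 1
        funext p
        refine Fin.cases rfl (fun p => rfl) p
      · intro w _ hw
        exact if_neg fun h => hw (List.ofFn_injective h.symm)
      · simp
  -- The tuple `u` is the coboundary of `b` in the associative algebra, as one sees by comparing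
  -- coefficients of words.
  have hud : ∀ j, toAssoc k (n + 1) (u j) = ∑ i ∈ Finset.range (n + 2),
      (-1 : k) ^ i • (coface n i j).elim 0 fun l => substAssoc (coface n i) (b l) := by
    intro j
    refine eq_of_wordCoeff_eq (toAssoc_mem_assocHomog (hu j)) ?_ fun w => ?_
    · refine Submodule.sum_mem _ fun i _ => Submodule.smul_mem _ _ ?_
      rcases coface n i j with _ | l
      · exact zero_mem _
      · exact substAssoc_mem _ (hb l)
    · have := h (Fin.cons j w)
      simp only [tupleCoeff, Fin.cons_zero, Fin.cons_succ, Option.elim_some] at this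
      rw [this, wordD]
      simp only [map_sum, map_smul, Finset.sum_apply, Pi.smul_apply, smul_eq_mul]
      refine Finset.sum_congr rfl fun i _ => ?_
      rw [← hbc]
      simp only [Fin.cons_zero, Fin.cons_succ]
      rcases coface n i j with _ | l
      · simp
      · simp only [Option.elim_some, wordCoeff_substAssoc, List.map_ofFn]
        rfl
  have hd' : (d : k) ≠ 0 := by exact_mod_cast hd
  -- The rescaled Dynkin map fixes Lie elements of degree `d` and commutes with substitutions, so it
  -- turns the associative primitive into a Lie one.
  refine ⟨fun i => (d : k)⁻¹ • dynkin (b i), fun i => Submodule.smul_mem _ _ (dynkin_mem (hb i)),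
    fun i => ?_, ?_⟩
  -- Normalization only matters in degree one, where the coefficient of `x_i` in the `i`-th
  -- component is the value of `g` at the word `i i`.
  · by_cases h1 : d = 1
    · subst h1
      rw [map_smul]
      simp only [b, map_sum, map_smul, smul_eq_mul]
      rw [Finset.sum_eq_zero, mul_zero]
      intro w _
      have e : wordProd k (List.ofFn w) = FreeAlgebra.ι k (w 0) := by simp [wordProd]
      rw [e, dynkin_ι, freeCoeff_of]
      split_ifs with h2
      · have : (fun p => some ((Fin.cons i w : Fin 2 → Fin n) p)) = fun _ => some i := by
          funext p
          fin_cases p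
          · rfl
          · exact congrArg some h2
        rw [this, hc rfl, zero_mul]
      · rw [mul_zero]
    · exact freeCoeff_eq_zero i h1 (Submodule.smul_mem _ _ (dynkin_mem (hb i)))
  · funext j
    have h1 : u j = (d : k)⁻¹ • dynkin (toAssoc k (n + 1) (u j)) := by
      rw [dynkin_toAssoc (hu j), smul_smul, inv_mul_cancel₀ hd', one_smul]
    rw [h1, hud j, freeD, map_sum, Finset.smul_sum]
    refine Finset.sum_congr rfl fun i _ => ?_
    rw [map_smul, smul_comm (d : k)⁻¹, freePull]
    rcases coface n i j with _ | l
    · simp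
    · simp [dynkin_substAssoc]

end
end TangentialDer
namespace TangentialDer

noncomputable section

variable {k : Type*} [Field k]

/-! ### Exactness for functions of chains of subsets -/

section Chains

variable {α : Type*} [Fintype α] [DecidableEq α]

/-- A function on pairs of nested proper nonempty subsets which is additive on flags is a
difference of a function on subsets, provided the obstruction for three-element sets vanishes. -/
theorem exists_potential (hα : 2 ≤ Fintype.card α) {Φ : Finset α → Finset α → k}
    (hΦ : ∀ S T U, S.Nonempty → S ⊆ T → T ⊆ U → U ≠ Finset.univ → Φ S U = Φ T U + Φ S T)
    (hex : ∀ p q r : α, p ≠ q → p ≠ r → q ≠ r → ({p, q, r} : Finset α) = Finset.univ →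
      Φ {q} {q, p} - Φ {p} {q, p} - Φ {q} {q, r} = Φ {r} {r, p} - Φ {p} {r, p} - Φ {r} {q, r}) :
    ∃ G : Finset α → k, ∀ S T, S.Nonempty → S ⊆ T → T ≠ Finset.univ → Φ S T = G S - G T := by
  obtain ⟨p, q, hpq⟩ := Fintype.exists_pair_of_one_lt_card (α := α) (by omega)
  have hself : ∀ S : Finset α, S.Nonempty → S ≠ Finset.univ → Φ S S = 0 := fun S h1 h2 => by
    have := hΦ S S S h1 subset_rfl subset_rfl h2
    linear_combination -this
  have hM : ∀ {S : Finset α}, S ≠ Finset.univ → insert p S = Finset.univ → S = {p}ᶜ := by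
    intro S h1 h2
    have hp : p ∉ S := fun hp => h1 (by rwa [Finset.insert_eq_self.2 hp] at h2)
    ext x
    have hx := Finset.mem_univ x
    rw [← h2, Finset.mem_insert] at hx
    simp only [Finset.mem_compl, Finset.mem_singleton]
    exact ⟨fun h e => hp (e ▸ h), fun h => hx.resolve_left h⟩
  -- Integration of `Φ` along the path `S ⊆ S ∪ {p} ⊇ {p}`. This contracts the poset to `{p}`,
  -- except at the complement of `p`, where `S ∪ {p}` is no longer proper.
  let G₀ : Finset α → k := fun S => Φ S (insert p S) - Φ {p} (insert p S)
  have h₀ : ∀ S T, S.Nonempty → S ⊆ T → insert p T ≠ Finset.univ → Φ S T = G₀ S - G₀ T := by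
    intro S T hS hST hT
    have hi := Finset.insert_subset_insert p hST
    have e1 := hΦ {p} (insert p S) (insert p T) (by simp) (by simp) hi hT
    have e2 := hΦ S (insert p S) (insert p T) hS (Finset.subset_insert _ _) hi hT
    have e3 := hΦ S T (insert p T) hS hST (Finset.subset_insert _ _) hT
    simp only [G₀]
    linear_combination e2 - e1 - e3
  have hMne : ({p}ᶜ : Finset α) ≠ Finset.univ := by simp
  -- The value at the missing vertex is forced by each singleton below it. Two singletons give the
  -- same value through their union with `{x, y}`, unless `{p, x, y}` is everything; then the poset
  -- is a hexagon and `hex` is needed.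
  have hsingle : ∀ x, x ≠ p → ∀ y, y ≠ p →
      G₀ {x} - Φ {x} {p}ᶜ = G₀ {y} - Φ {y} {p}ᶜ := by
    intro x hx y hy
    rcases eq_or_ne x y with rfl | hxy
    · rfl
    · by_cases h : ({p, x, y} : Finset α) = Finset.univ
      · have e : ({p}ᶜ : Finset α) = {x, y} := (hM (by
          intro h'
          have : p ∈ ({x, y} : Finset α) := h' ▸ Finset.mem_univ p
          simp [hx.symm, hy.symm] at this) h).symm
        have := hex p x y hx.symm hy.symm hxy h
        simp only [G₀, e, Finset.pair_comm p]
        exact this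
      · have hs : ({x, y} : Finset α) ⊆ {p}ᶜ := by
          intro z hz
          simp only [Finset.mem_insert, Finset.mem_singleton, Finset.mem_compl] at hz ⊢
          rcases hz with rfl | rfl <;> assumption
        have e1 := h₀ {x} {x, y} (by simp) (by simp) h
        have e2 := h₀ {y} {x, y} (by simp) (by simp) h
        have e3 := hΦ {x} {x, y} {p}ᶜ (by simp) (by simp) hs hMne
        have e4 := hΦ {y} {x, y} {p}ᶜ (by simp) (by simp) hs hMne
        linear_combination e2 - e1 - e3 + e4
  -- The value at the complement of `p` is read off from the singleton `{q}`; by `hsingle` the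
  -- choice of `q` is irrelevant.
  refine ⟨fun S => if S = {p}ᶜ then G₀ {q} - Φ {q} {p}ᶜ else G₀ S, fun S T hS hST hT => ?_⟩
  by_cases hTM : T = {p}ᶜ
  · subst hTM
    dsimp only
    rw [if_pos rfl]
    split_ifs with h
    · subst h
      rw [hself _ hS hT, sub_self]
    · have hSu : S ≠ Finset.univ := fun e => hT (Finset.univ_subset_iff.1 (e ▸ hST))
      have hi : insert p S ≠ Finset.univ := fun e => h (hM hSu e)
      obtain ⟨x, hx⟩ := hS
      have hxp : x ≠ p := by simpa using hST hx
      have hxS : {x} ⊆ S := by simpa using hx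
      have e1 := h₀ {x} S (by simp) hxS hi
      have e2 := hΦ {x} S {p}ᶜ (by simp) hxS hST hT
      have e3 := hsingle q hpq.symm x hxp
      linear_combination e3 - e1 - e2
  · have hi : insert p T ≠ Finset.univ := fun e => hTM (hM hT e)
    dsimp only
    rw [if_neg hTM, if_neg, h₀ S T hS hST hi]
    rintro rfl
    refine hi (Finset.eq_univ_of_forall fun x => ?_)
    by_cases hx : x = p
    · simp [hx]
    · exact Finset.mem_insert_of_mem (hST (by simpa using hx))

/-! ### Words in few letters as chains of subsets -/

/-- The word in two letters with first letter at the places in `S`. -/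
def word2 (S : Finset α) (p : α) : Fin 2 := if p ∈ S then 0 else 1

/-- The word in three letters with first letter on `S` and second letter on `T \ S`. -/
def word3 (S T : Finset α) (p : α) : Fin 3 := if p ∈ S then 0 else if p ∈ T then 1 else 2

/-- The word in four letters with the first letters on `S`, `T \ S`, `U \ T`. -/
def word4 (S T U : Finset α) (p : α) : Fin 4 :=
  if p ∈ S then 0 else if p ∈ T then 1 else if p ∈ U then 2 else 3

theorem exists_word2 (w : α → Fin 2) : ∃ S, w = word2 S := by
  refine ⟨Finset.univ.filter fun p => w p = 0, funext fun p => ?_⟩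
  simp only [word2, Finset.mem_filter, Finset.mem_univ, true_and]
  generalize w p = i
  decide +revert

theorem exists_word3 (w : α → Fin 3) : ∃ S T, S ⊆ T ∧ w = word3 S T := by
  refine ⟨Finset.univ.filter fun p => w p = 0, Finset.univ.filter fun p => w p ≤ 1,
    fun p hp => ?_, funext fun p => ?_⟩
  · simp only [Finset.mem_filter, Finset.mem_univ, true_and] at hp ⊢
    simp [hp]
  · simp only [word3, Finset.mem_filter, Finset.mem_univ, true_and]
    generalize w p = i
    decide +revert

theorem wordD_word2 {g : (α → Option (Fin 1)) → k} (hg : ∀ w, (∃ p, w p = none) → g w = 0)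
    (S : Finset α) : wordD g (word2 S) = (if S = ∅ then g (fun _ => some 0) else 0) -
      g (fun _ => some 0) + if S = Finset.univ then g (fun _ => some 0) else 0 := by
  have e0 : g (fun p => coface 1 0 (word2 S p)) = if S = ∅ then g (fun _ => some 0) else 0 := by
    split_ifs with h
    · subst h
      rfl
    · obtain ⟨p, hp⟩ := Finset.nonempty_iff_ne_empty.2 h
      exact hg _ ⟨p, by simp [word2, hp, coface]⟩
  have e1 : (fun p => coface 1 1 (word2 S p)) = fun _ => some 0 := by
    funext p
    by_cases h1 : p ∈ S <;> simp [word2, h1, coface]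
  have e2 : g (fun p => coface 1 2 (word2 S p)) =
      if S = Finset.univ then g (fun _ => some 0) else 0 := by
    split_ifs with h
    · subst h
      congr 1
      funext p
      simp [word2, coface]
    · obtain ⟨p, hp⟩ := not_forall.1 (mt Finset.eq_univ_iff_forall.2 h)
      exact hg _ ⟨p, by simp [word2, hp, coface]⟩
  simp only [wordD, Finset.sum_range_succ, Finset.sum_range_zero, e0, e1, e2]
  ring

/-- Merging letters forgets one subset of the chain. Dropping the first letter is undefined on `S`,
and dropping the last is undefined outside `T`, so these two terms survive only for `S = ∅` and for
`T` everything. -/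
theorem wordD_word3 {g : (α → Option (Fin 2)) → k} (hg : ∀ w, (∃ p, w p = none) → g w = 0)
    {S T : Finset α} (hST : S ⊆ T) :
    wordD g (word3 S T) = (if S = ∅ then g (fun p => some (word2 T p)) else 0) -
      g (fun p => some (word2 T p)) + g (fun p => some (word2 S p)) -
      if T = Finset.univ then g (fun p => some (word2 S p)) else 0 := by
  have e0 : g (fun p => coface 2 0 (word3 S T p)) =
      if S = ∅ then g (fun p => some (word2 T p)) else 0 := by
    split_ifs with h
    · subst h
      congr 1
      funext p
      by_cases h1 : p ∈ T <;> simp [word2, word3, h1, coface]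
    · obtain ⟨p, hp⟩ := Finset.nonempty_iff_ne_empty.2 h
      exact hg _ ⟨p, by simp [word3, hp, coface]⟩
  have e1 : (fun p => coface 2 1 (word3 S T p)) = fun p => some (word2 T p) := by
    funext p
    by_cases h1 : p ∈ S
    · simp [word2, word3, h1, hST h1, coface]
    · by_cases h2 : p ∈ T <;> simp [word2, word3, h1, h2, coface]
  have e2 : (fun p => coface 2 2 (word3 S T p)) = fun p => some (word2 S p) := by
    funext p
    by_cases h1 : p ∈ S
    · simp [word2, word3, h1, coface]
    · by_cases h2 : p ∈ T <;> simp [word2, word3, h1, h2, coface]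
  have e3 : g (fun p => coface 2 3 (word3 S T p)) =
      if T = Finset.univ then g (fun p => some (word2 S p)) else 0 := by
    split_ifs with h
    · subst h
      congr 1
      funext p
      by_cases h1 : p ∈ S <;> simp [word2, word3, h1, coface]
    · obtain ⟨p, hp⟩ := not_forall.1 (mt Finset.eq_univ_iff_forall.2 h)
      have hp' : p ∉ S := fun h => hp (hST h)
      exact hg _ ⟨p, by simp [word3, hp, hp', coface]⟩
  simp only [wordD, Finset.sum_range_succ, Finset.sum_range_zero, e0, e1, e2, e3]
  ring

theorem wordD_word4 {F : (α → Option (Fin 3)) → k} (hF : ∀ w, (∃ p, w p = none) → F w = 0)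
    {S T U : Finset α} (hST : S ⊆ T) (hTU : T ⊆ U) :
    wordD F (word4 S T U) = (if S = ∅ then F (fun p => some (word3 T U p)) else 0) -
      F (fun p => some (word3 T U p)) + F (fun p => some (word3 S U p)) -
      F (fun p => some (word3 S T p)) +
      if U = Finset.univ then F (fun p => some (word3 S T p)) else 0 := by
  have hletter : ∀ p,
      (word4 S T U p = 0 ∧ p ∈ S ∧ p ∈ T ∧ p ∈ U) ∨ (word4 S T U p = 1 ∧ p ∉ S ∧ p ∈ T ∧ p ∈ U) ∨
      (word4 S T U p = 2 ∧ p ∉ S ∧ p ∉ T ∧ p ∈ U) ∨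
      (word4 S T U p = 3 ∧ p ∉ S ∧ p ∉ T ∧ p ∉ U) := by
    intro p
    have h1 := @hST p
    have h2 := @hTU p
    by_cases hU : p ∈ U <;> by_cases hT : p ∈ T <;> by_cases hS : p ∈ S <;>
      simp_all [word4]
  have e0 : F (fun p => coface 3 0 (word4 S T U p)) =
      if S = ∅ then F (fun p => some (word3 T U p)) else 0 := by
    split_ifs with h
    · congr 1
      funext p
      rcases hletter p with h1 | h1 | h1 | h1 <;> simp_all [word3, coface]
    · obtain ⟨p, hp⟩ := Finset.nonempty_iff_ne_empty.2 h
      exact hF _ ⟨p, by simp [word4, hp, coface]⟩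
  have e1 : (fun p => coface 3 1 (word4 S T U p)) = fun p => some (word3 T U p) := by
    funext p
    rcases hletter p with h1 | h1 | h1 | h1 <;> simp [word3, coface, h1]
  have e2 : (fun p => coface 3 2 (word4 S T U p)) = fun p => some (word3 S U p) := by
    funext p
    rcases hletter p with h1 | h1 | h1 | h1 <;> simp [word3, coface, h1]
  have e3 : (fun p => coface 3 3 (word4 S T U p)) = fun p => some (word3 S T p) := by
    funext p
    rcases hletter p with h1 | h1 | h1 | h1 <;> simp [word3, coface, h1]
  have e4 : F (fun p => coface 3 4 (word4 S T U p)) =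
      if U = Finset.univ then F (fun p => some (word3 S T p)) else 0 := by
    split_ifs with h
    · congr 1
      funext p
      rcases hletter p with h1 | h1 | h1 | h1 <;> simp_all [word3, coface]
    · obtain ⟨p, hp⟩ := not_forall.1 (mt Finset.eq_univ_iff_forall.2 h)
      have h1 : word4 S T U p = 3 := by rcases hletter p with h1 | h1 | h1 | h1 <;> simp_all
      exact hF _ ⟨p, by simp [h1, coface]⟩
  simp only [wordD, Finset.sum_range_succ, Finset.sum_range_zero, e0, e1, e2, e3, e4]
  ring

/-! ### Exactness of the word complex for two and three letters -/

/-- In word length at least three, cocycles in two letters are coboundaries. -/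
theorem exists_wordD_one_eq (hα : 3 ≤ Fintype.card α) {f : (α → Option (Fin 2)) → k}
    (hf : ∀ w, (∃ p, w p = none) → f w = 0) (hd : ∀ w : α → Fin 3, wordD f w = 0) :
    ∃ g : (α → Option (Fin 1)) → k, (∀ w, (∃ p, w p = none) → g w = 0) ∧
      ∀ w : α → Fin 2, f (fun p => some (w p)) = wordD g w := by
  have : Nonempty α := Fintype.card_pos_iff.1 (by omega)
  obtain ⟨x⟩ := this
  let Φ : Finset α → k := fun S => f fun p => some (word2 S p)
  have hne : (Finset.univ : Finset α) ≠ ∅ := (Finset.univ_nonempty_iff.2 ⟨x⟩).ne_empty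
  have hc : ∀ S T, S ⊆ T → (if S = ∅ then Φ T else 0) - Φ T + Φ S -
      (if T = Finset.univ then Φ S else 0) = 0 := fun S T h => by rw [← wordD_word3 hf h, hd]
  have h0 : Φ ∅ = 0 := by simpa [hne.symm] using hc ∅ ∅ subset_rfl
  have h1 : Φ Finset.univ = 0 := by
    simpa [hne] using hc Finset.univ Finset.univ subset_rfl
  have hST : ∀ S T, S.Nonempty → S ⊆ T → T ≠ Finset.univ → Φ S = Φ T := by
    intro S T hS h hT
    have := hc S T h
    rw [if_neg hS.ne_empty, if_neg hT] at this
    linear_combination this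
  -- Connectedness: with at least three places `{x, y}` is proper, so `S ⊇ {y} ⊆ {x, y} ⊇ {x}` is a
  -- path of proper nonempty subsets.
  have hconst : ∀ S, S.Nonempty → S ≠ Finset.univ → Φ S = Φ {x} := by
    rintro S ⟨y, hy⟩ hS
    have hxy : ({x, y} : Finset α) ≠ Finset.univ := fun e => by
      have h2 := Finset.card_le_two (a := x) (b := y)
      rw [e, Finset.card_univ] at h2
      omega
    rw [← hST {y} S (by simp) (by simpa using hy) hS, hST {y} {x, y} (by simp) (by simp) hxy,
      hST {x} {x, y} (by simp) (by simp) hxy]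
  classical
  have hg : ∀ w : α → Option (Fin 1), (∃ p, w p = none) →
      (if ∃ p, w p = none then 0 else -Φ {x}) = 0 := fun w hw => if_pos hw
  -- The sign comes from the middle term of the differential, the only one present at proper
  -- nonempty subsets.
  refine ⟨fun w => if ∃ p, w p = none then 0 else -Φ {x}, hg, fun w => ?_⟩
  obtain ⟨S, rfl⟩ := exists_word2 w
  rw [wordD_word2 hg]
  change Φ S = _
  by_cases hS : S = ∅
  · subst hS
    simp [h0, hne.symm]
  · by_cases hS' : S = Finset.univ
    · subst hS'
      simp [h1, hne]
    · simp [hS, hS', hconst S (Finset.nonempty_iff_ne_empty.2 hS) hS']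

/-- Cocycles in three letters which vanish at the words `11…1` and `33…3` are coboundaries, up to
the obstruction in word length three. -/
theorem exists_wordD_two_eq (hα : 2 ≤ Fintype.card α) {F : (α → Option (Fin 3)) → k}
    (hF : ∀ w, (∃ p, w p = none) → F w = 0) (hd : ∀ w : α → Fin 4, wordD F w = 0)
    (hF0 : F (fun _ => some 0) = 0) (hF2 : F (fun _ => some 2) = 0)
    (hex : ∀ p q r : α, p ≠ q → p ≠ r → q ≠ r → ({p, q, r} : Finset α) = Finset.univ →
      F (fun x => some (word3 {q} {q, p} x)) - F (fun x => some (word3 {p} {q, p} x)) -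
          F (fun x => some (word3 {q} {q, r} x)) =
        F (fun x => some (word3 {r} {r, p} x)) - F (fun x => some (word3 {p} {r, p} x)) -
          F (fun x => some (word3 {r} {q, r} x))) :
    ∃ g : (α → Option (Fin 2)) → k, (∀ w, (∃ p, w p = none) → g w = 0) ∧
      (∀ w : α → Fin 3, F (fun p => some (w p)) = wordD g w) ∧
      ∀ i, g (fun _ => some i) = 0 := by
  have : Nonempty α := Fintype.card_pos_iff.1 (by omega)
  obtain ⟨x⟩ := this
  let Φ : Finset α → Finset α → k := fun S T => F fun p => some (word3 S T p)
  have hne : (Finset.univ : Finset α) ≠ ∅ := (Finset.univ_nonempty_iff.2 ⟨x⟩).ne_empty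
  have hc : ∀ S T U, S ⊆ T → T ⊆ U → (if S = ∅ then Φ T U else 0) - Φ T U + Φ S U - Φ S T +
      (if U = Finset.univ then Φ S T else 0) = 0 :=
    fun S T U h1 h2 => by rw [← wordD_word4 hF h1 h2, hd]
  -- The chain `∅, ∅` is the word `33…3` and the full chain is `11…1`. Through the cocycle identity,
  -- these two values determine all values on chains that start at `∅` or end at the whole set.
  have h00 : Φ ∅ ∅ = 0 := by
    rw [← hF2]
    simp [Φ, word3]
  have h11 : Φ Finset.univ Finset.univ = 0 := by
    rw [← hF0]
    simp [Φ, word3]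
  have h0 : ∀ T, Φ ∅ T = 0 := by
    intro T
    have := hc ∅ ∅ T subset_rfl (by simp)
    simpa [h00] using this
  have h1 : ∀ S, Φ S Finset.univ = 0 := by
    intro S
    have := hc S Finset.univ Finset.univ (by simp) subset_rfl
    simpa [h11] using this
  obtain ⟨G, hG⟩ := exists_potential hα (Φ := Φ) (fun S T U hS h1 h2 hU => by
    have := hc S T U h1 h2
    rw [if_neg hS.ne_empty, if_neg hU] at this
    linear_combination this) hex
  classical
  -- The potential `G` is overwritten by zero at `∅` and at the whole set; these values are also
  -- what keeps the primitive normalized in degree one.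
  let g : (α → Option (Fin 2)) → k := fun w => if ∃ p, w p = none then 0 else
    if (∀ p, w p = some 0) ∨ ∀ p, w p = some 1 then 0 else
      G (Finset.univ.filter fun p => w p = some 0)
  have hg : ∀ w, (∃ p, w p = none) → g w = 0 := fun w hw => if_pos hw
  have hg2 : ∀ S, g (fun p => some (word2 S p)) =
      if S = Finset.univ ∨ S = ∅ then 0 else G S := by
    intro S
    have e1 : (∀ p, some (word2 S p) = some 0) ↔ S = Finset.univ := by
      simp [word2, Finset.eq_univ_iff_forall]
    have e2 : (∀ p, some (word2 S p) = some 1) ↔ S = ∅ := by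
      simp [word2, Finset.eq_empty_iff_forall_notMem]
    have e3 : (Finset.univ.filter fun p => some (word2 S p) = some 0) = S := by
      ext p
      simp [word2]
    simp only [g, e1, e2, e3]
    simp
  refine ⟨g, hg, fun w => ?_, fun i => ?_⟩
  · obtain ⟨S, T, hST, rfl⟩ := exists_word3 w
    rw [wordD_word3 hg hST, hg2, hg2]
    change Φ S T = _
    by_cases hS : S = ∅
    · subst hS
      simp [h0]
    · by_cases hT : T = Finset.univ
      · subst hT
        simp [h1, hS]
      · have hS' : S ≠ Finset.univ := fun e => hT (Finset.univ_subset_iff.1 (e ▸ hST))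
        have hT' : T ≠ ∅ := fun e => hS (Finset.subset_empty.1 (e ▸ hST))
        simp only [hS, hT, hS', hT', if_false, or_self]
        rw [hG S T (Finset.nonempty_iff_ne_empty.2 hS) hST hT]
        ring
  · fin_cases i <;> simp [g]

end Chains

end
end TangentialDer
namespace TangentialDer

noncomputable section

open CLie

variable {k : Type*} [Field k] {n m : ℕ}

/-! ### Homogeneous components of tangential derivations -/

theorem lieHomog_one_letter (d : ℕ) {a : FreeLieAlgebra k (Fin 1)}
    (ha : a ∈ lieHomog k 1 (d + 2)) : a = 0 := by
  induction d generalizing a with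
  | zero =>
    obtain ⟨b, hb, rfl⟩ := lieHomog_succ le_rfl ha
    refine Finset.sum_eq_zero fun i _ => ?_
    rw [lieHomog_one (hb i), Fin.sum_univ_one, Subsingleton.elim i 0, lie_smul, lie_self, smul_zero]
  | succ d ih =>
    obtain ⟨b, hb, rfl⟩ := lieHomog_succ (by omega) ha
    refine Finset.sum_eq_zero fun i _ => ?_
    rw [ih (hb i), lie_zero]

instance : Subsingleton (normTuple k 1) := by
  refine subsingleton_of_forall_eq 0 fun a => Subtype.ext (funext fun i => CLie.ext fun d => ?_)
  match d with
  | 0 => rw [comp_zero_right, comp_zero_right]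
  | 1 =>
    have h : freeCoeff k i ((a.1 i).comp 1) = 0 := a.2 i
    rw [lieHomog_one ((a.1 i).comp_mem 1), Fin.sum_univ_one, Subsingleton.elim 0 i, h, zero_smul]
    rfl
  | d + 2 => exact lieHomog_one_letter d ((a.1 i).comp_mem _)

/-- Restriction to the single letter `x_i` lands in the normalized one-letter tuples, which vanish:
Lie elements of degree at least two in one letter are zero, and normalization removes the linear
term. -/
theorem tupleCoeff_const_eq_zero (a : normTuple k n) (d : ℕ) (i : Fin n) :
    tupleCoeff (d := d) (fun j => (a.1 j).comp d) (fun _ => some i) = 0 := by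
  have h : tuplePull (fun _ : Fin 1 => some i) a = 0 := Subsingleton.elim _ _
  have h2 : freePull (fun _ : Fin 1 => some i) (fun j => (a.1 j).comp d) = fun _ => 0 := by
    funext j
    have := congrArg (fun b : normTuple k 1 => (b.1 j).comp d) h
    simpa [tuplePull_apply, freePull, comp_substFiber] using this
  have h3 := tupleCoeff_freePull (fun _ : Fin 1 => some i) (fun j => (a.1 j).comp d)
    (d := d) (fun _ => 0)
  rw [← h3, h2]
  simp [tupleCoeff]

/-! ### The obstruction in word length three -/

/-- The alternating sum around the hexagon of complete flags in `{0, 1, 2}`. -/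
def hexagonSum (Φ : Finset (Fin 3) → Finset (Fin 3) → k) : k :=
  Φ {0} {0, 1} - Φ {1} {0, 1} + Φ {1} {1, 2} - Φ {2} {1, 2} + Φ {2} {0, 2} - Φ {0} {0, 2}

/-- On strict flags the coboundary is the difference of the values at the two ends of an edge, so
the sum around the closed hexagon telescopes. -/
theorem hexagonSum_wordD {g : (Fin 3 → Option (Fin 2)) → k}
    (hg : ∀ w, (∃ p, w p = none) → g w = 0) :
    hexagonSum (fun S T => wordD g (word3 S T)) = 0 := by
  have h : ∀ S T : Finset (Fin 3), S ≠ ∅ → S ⊆ T → T ≠ Finset.univ → wordD g (word3 S T) =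
      g (fun p => some (word2 S p)) - g (fun p => some (word2 T p)) := by
    intro S T hS hST hT
    rw [wordD_word3 hg hST, if_neg hS, if_neg hT]
    ring
  rw [hexagonSum, h {0} {0, 1} (by decide) (by decide) (by decide),
    h {1} {0, 1} (by decide) (by decide) (by decide),
    h {1} {1, 2} (by decide) (by decide) (by decide),
    h {2} {1, 2} (by decide) (by decide) (by decide),
    h {2} {0, 2} (by decide) (by decide) (by decide),
    h {0} {0, 2} (by decide) (by decide) (by decide)]
  ring

variable [CharZero k]

instance : Subsingleton (dert k 1) := (tupleEquiv k 1).symm.toEquiv.subsingleton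

/-- The components of degree `e` of the normalized tuple of a tangential derivation. -/
def tupleComp (u : dert k n) (e : ℕ) (i : Fin n) : FreeLieAlgebra k (Fin n) :=
  (((tupleEquiv k n).symm u).1 i).comp e

theorem tupleComp_mem (u : dert k n) (e : ℕ) (i : Fin n) : tupleComp u e i ∈ lieHomog k n e :=
  comp_mem _ _

theorem tupleComp_ext {u v : dert k n} (h : ∀ e, tupleComp u e = tupleComp v e) : u = v :=
  (tupleEquiv k n).symm.injective <| Subtype.ext <| funext fun i => CLie.ext fun e =>
    congrFun (h e) i

theorem tupleComp_add (u v : dert k n) (e : ℕ) :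
    tupleComp (u + v) e = tupleComp u e + tupleComp v e := by
  funext i
  simp [tupleComp]

theorem tupleComp_smul (c : k) (u : dert k n) (e : ℕ) :
    tupleComp (c • u) e = c • tupleComp u e := by
  funext i
  simp [tupleComp]

theorem tupleComp_zero (e : ℕ) : tupleComp (0 : dert k n) e = 0 := by
  funext i
  simp [tupleComp]

theorem tupleComp_zero_right (u : dert k n) : tupleComp u 0 = 0 :=
  funext fun _ => comp_zero_right _

theorem tupleComp_tupleEquiv (a : normTuple k n) (e : ℕ) (i : Fin n) :
    tupleComp (tupleEquiv k n a) e i = (a.1 i).comp e := by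
  simp [tupleComp]

theorem tupleComp_d (u : dert k n) (e : ℕ) : tupleComp (d k n u) e = freeD (tupleComp u e) := by
  funext j
  have h : ∀ φ : Fin (n + 1) → Option (Fin n),
      tupleComp (dertPull φ u) e j = freePull φ (tupleComp u e) j := by
    intro φ
    simp only [tupleComp, dertPull, LinearMap.comp_apply, LinearEquiv.coe_coe,
      LinearEquiv.symm_apply_apply, tuplePull_apply, freePull]
    rcases φ j with _ | i
    · rfl
    · rfl
  rw [freeD]
  simp only [← h]
  simp [tupleComp, d_eq_sum, LinearMap.sum_apply]

theorem freeD_zero : freeD (0 : Fin n → FreeLieAlgebra k (Fin n)) = 0 := by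
  have := tupleComp_d (0 : dert k n) 0
  rwa [map_zero, tupleComp_zero, tupleComp_zero, eq_comm] at this

theorem wordD_tupleCoeff_of_mem_ker {u : dert k n} (hu : u ∈ LinearMap.ker (d k n)) (e : ℕ)
    (w : Fin (e + 1) → Fin (n + 1)) : wordD (tupleCoeff (tupleComp u e)) w = 0 := by
  rw [← tupleCoeff_freeD, ← tupleComp_d, LinearMap.mem_ker.1 hu, tupleComp_zero]
  simp [tupleCoeff]

/-- The differential preserves the degree and the completion is a product, so primitives can be
chosen degree by degree. -/
theorem mem_range_d {u : dert k (n + 1)} (h : ∀ e, e ≠ 0 → ∃ v : Fin n → FreeLieAlgebra k (Fin n),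
    (∀ i, v i ∈ lieHomog k n e) ∧ (∀ i, freeCoeff k i (v i) = 0) ∧ freeD v = tupleComp u e) :
    u ∈ LinearMap.range (d k n) := by
  have h' : ∀ e, ∃ v : Fin n → FreeLieAlgebra k (Fin n),
      (∀ i, v i ∈ lieHomog k n e) ∧ (∀ i, freeCoeff k i (v i) = 0) ∧ freeD v = tupleComp u e := by
    intro e
    rcases eq_or_ne e 0 with rfl | he
    · exact ⟨0, fun i => zero_mem _, fun i => map_zero _, by
        rw [freeD_zero, tupleComp_zero_right]⟩
    · exact h e he
  choose v hv hv0 hvd using h'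
  refine ⟨tupleEquiv k n ⟨fun i => CLie.mk (fun e => v e i) fun e => hv e i, fun i => hv0 1 i⟩,
    tupleComp_ext fun e => ?_⟩
  rw [tupleComp_d, ← hvd]
  congr 1
  funext i
  rw [tupleComp_tupleEquiv]
  rfl

/-! ### The second cohomology -/

theorem tupleComp_r (e : ℕ) :
    tupleComp (r k) e = if e = 1 then ![FreeLieAlgebra.of k 1, 0] else 0 := by
  funext i
  rw [r, tupleComp_tupleEquiv]
  fin_cases i <;> by_cases h : e = 1 <;> simp [comp_X, h]

theorem tupleComp_t (e : ℕ) :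
    tupleComp (t k) e = if e = 1 then ![FreeLieAlgebra.of k 1, FreeLieAlgebra.of k 0] else 0 := by
  funext i
  rw [t, tupleComp_tupleEquiv]
  fin_cases i <;> by_cases h : e = 1 <;> simp [comp_X, h]

theorem r_mem_ker : r k ∈ LinearMap.ker (d k 2) := by
  refine LinearMap.mem_ker.2 (tupleComp_ext fun e => ?_)
  rw [tupleComp_d, tupleComp_zero, tupleComp_r]
  split_ifs
  · funext j
    fin_cases j <;>
      simp [freeD, freePull, coface, substLie_of, Finset.sum_range_succ, Finset.sum_filter,
        Fin.sum_univ_succ, pow_succ]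
  · exact freeD_zero

theorem t_mem_ker : t k ∈ LinearMap.ker (d k 2) := by
  refine LinearMap.mem_ker.2 (tupleComp_ext fun e => ?_)
  rw [tupleComp_d, tupleComp_zero, tupleComp_t]
  split_ifs
  · funext j
    fin_cases j <;>
      simp [freeD, freePull, coface, substLie_of, Finset.sum_range_succ, Finset.sum_filter,
        Fin.sum_univ_succ, pow_succ]
  · exact freeD_zero

/-- For `e ≥ 2` words have length at least three, so the component is the coboundary of a tuple in
one letter, and the free Lie algebra on one letter is zero in such degrees. -/
theorem tupleComp_eq_zero_of_mem_ker {u : dert k 2} (hu : u ∈ LinearMap.ker (d k 2)) {e : ℕ}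
    (he : e ≠ 1) : tupleComp u e = 0 := by
  rcases eq_or_ne e 0 with rfl | he0
  · exact tupleComp_zero_right u
  obtain ⟨g, hg, hgd⟩ := exists_wordD_one_eq (α := Fin (e + 1)) (by simp; omega)
    (fun _ => tupleCoeff_of_none (tupleComp u e)) (wordD_tupleCoeff_of_mem_ker hu e)
  obtain ⟨v, hv, -, hvd⟩ := exists_freeD_eq he0 (tupleComp_mem u e) hg hgd fun h => absurd h he
  have : v = 0 := by
    funext i
    obtain ⟨e', rfl⟩ : ∃ e', e = e' + 2 := ⟨e - 2, by omega⟩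
    exact lieHomog_one_letter e' (hv i)
  rw [← hvd, this, freeD_zero]

theorem ker_d_two : LinearMap.ker (d k 2) = Submodule.span k {r k, t k} := by
  refine le_antisymm (fun u hu => ?_) (Submodule.span_le.2 ?_)
  · rw [Submodule.mem_span_pair]
    have h0 : freeCoeff k 0 (tupleComp u 1 0) = 0 := ((tupleEquiv k 2).symm u).2 0
    have h1 : freeCoeff k 1 (tupleComp u 1 1) = 0 := ((tupleEquiv k 2).symm u).2 1
    -- A normalized linear tuple is `(α y, β x) = (α - β) r + β t`.
    refine ⟨freeCoeff k 1 (tupleComp u 1 0) - freeCoeff k 0 (tupleComp u 1 1),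
      freeCoeff k 0 (tupleComp u 1 1), tupleComp_ext fun e => ?_⟩
    rw [tupleComp_add, tupleComp_smul, tupleComp_smul, tupleComp_r, tupleComp_t]
    split_ifs with he
    · subst he
      funext i
      rw [lieHomog_one (tupleComp_mem u 1 i)]
      fin_cases i
      · simp [h0, sub_smul]
      · simp [h1]
    · rw [tupleComp_eq_zero_of_mem_ker hu he]
      simp
  · rintro _ (rfl | rfl)
    exacts [r_mem_ker, t_mem_ker]

theorem linearIndependent_r_t : LinearIndependent k ![r k, t k] := by
  rw [LinearIndependent.pair_iff]
  intro a b h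
  have h' := congrArg (fun u => tupleComp u 1) h
  simp only [tupleComp_add, tupleComp_smul, tupleComp_r, tupleComp_t, if_true,
    tupleComp_zero] at h'
  have h0 := congrArg (freeCoeff k 1) (congrFun h' 0)
  have h1 := congrArg (freeCoeff k 0) (congrFun h' 1)
  simp [freeCoeff_of] at h0 h1
  subst h1
  simpa using h0

theorem bijective_mkQ_coboundaries_two : Function.Bijective
    ((coboundaries k 2).submoduleOf (LinearMap.ker (d k 2))).mkQ := by
  refine ⟨?_, Submodule.mkQ_surjective _⟩
  rw [← LinearMap.ker_eq_bot, Submodule.ker_mkQ, Submodule.submoduleOf]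
  have : coboundaries k 2 = ⊥ := by
    rw [coboundaries, LinearMap.range_eq_bot]
    ext1 v
    rw [Subsingleton.elim v 0, map_zero, map_zero]
  rw [this, Submodule.comap_bot, Submodule.ker_subtype]

/-! ### The third cohomology -/

/-- The alternating sum of the coefficients of the words with three distinct letters. -/
def altCoeff : dert k 3 →ₗ[k] k where
  toFun u := hexagonSum fun S T => tupleCoeff (tupleComp u 2) fun p => some (word3 S T p)
  map_add' u v := by
    simp only [hexagonSum, tupleCoeff, Option.elim_some, tupleComp_add, Pi.add_apply, map_add]
    ring
  map_smul' c u := by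
    simp only [hexagonSum, tupleCoeff, Option.elim_some, tupleComp_smul, Pi.smul_apply, map_smul,
      smul_eq_mul, RingHom.id_apply]
    ring

theorem altCoeff_apply (u : dert k 3) : altCoeff u =
    hexagonSum fun S T => tupleCoeff (tupleComp u 2) fun p => some (word3 S T p) := rfl

theorem altCoeff_d (v : dert k 2) : altCoeff (d k 2 v) = 0 := by
  rw [altCoeff_apply, tupleComp_d]
  simp only [tupleCoeff_freeD]
  exact hexagonSum_wordD fun _ => tupleCoeff_of_none _

theorem mem_range_of_altCoeff_eq_zero {u : dert k 3} (hu : u ∈ LinearMap.ker (d k 3))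
    (h : altCoeff u = 0) : u ∈ LinearMap.range (d k 2) := by
  refine mem_range_d fun e he => ?_
  obtain ⟨g, hg, hgd, hg0⟩ := exists_wordD_two_eq (α := Fin (e + 1)) (by simp; omega)
    (fun _ => tupleCoeff_of_none (tupleComp u e)) (wordD_tupleCoeff_of_mem_ker hu e)
    -- The obstruction concerns three places only, hence `e = 2`; for each of the six orderings of
    -- the places it is the hexagon relation up to sign.
    (tupleCoeff_const_eq_zero _ e 0) (tupleCoeff_const_eq_zero _ e 2) (fun p q r hpq hpr hqr hun => by
      obtain rfl : e = 2 := by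
        have := congrArg Finset.card hun
        rw [Finset.card_eq_three.2 ⟨p, q, r, hpq, hpr, hqr, rfl⟩] at this
        simpa using this.symm
      rw [altCoeff_apply] at h
      generalize tupleCoeff (tupleComp u 2) = F at h
      have e01 : ({1, 0} : Finset (Fin 3)) = {0, 1} := by decide
      have e02 : ({2, 0} : Finset (Fin 3)) = {0, 2} := by decide
      have e12 : ({2, 1} : Finset (Fin 3)) = {1, 2} := by decide
      simp only [hexagonSum] at h
      fin_cases p <;> fin_cases q <;> fin_cases r <;> first
        | exact absurd rfl hpq
        | exact absurd rfl hpr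
        | exact absurd rfl hqr
        | (simp only [Fin.zero_eta, Fin.mk_one, Fin.reduceFinMk, e01, e02, e12]
           first | linear_combination h | linear_combination -h))
  exact exists_freeD_eq he (tupleComp_mem u e) hg hgd fun _ => hg0

theorem tupleComp_zxElt (e : ℕ) : tupleComp (zxElt k) e =
    if e = 2 then ![0, ⁅FreeLieAlgebra.of k (2 : Fin 3), FreeLieAlgebra.of k (0 : Fin 3)⁆, 0] else 0 := by
  have h : ⁅X k (2 : Fin 3), X k (0 : Fin 3)⁆.comp e =
      if e = 2 then ⁅FreeLieAlgebra.of k (2 : Fin 3), FreeLieAlgebra.of k (0 : Fin 3)⁆ else 0 := by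
    rcases e with _ | e
    · simp
    · rw [comp_X_lie, comp_X]
      by_cases he : e = 1 <;> simp [he]
  funext i
  rw [zxElt, tupleComp_tupleEquiv]
  fin_cases i
  · by_cases he : e = 2 <;> simp [he]
  · refine h.trans ?_
    by_cases he : e = 2 <;> simp [he]
  · by_cases he : e = 2 <;> simp [he]

/-- Only the second and third components of the image receive nonzero terms, three each. They cancel
by bilinearity: `[x_4, x_1] - [x_3 + x_4, x_1] + [x_3, x_1] = 0`, and similarly for the other. -/
theorem zxElt_mem_ker : zxElt k ∈ LinearMap.ker (d k 3) := by
  refine LinearMap.mem_ker.2 (tupleComp_ext fun e => ?_)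
  rw [tupleComp_d, tupleComp_zero, tupleComp_zxElt]
  split_ifs
  · have h : ∀ (i : ℕ) (l : Fin 3) (s : Finset (Fin 4)),
        Finset.univ.filter (fun j => coface 3 i j = some l) = s →
        substLie (coface 3 i) (FreeLieAlgebra.of k l) = ∑ j ∈ s, FreeLieAlgebra.of k j :=
      fun i l s hs => by rw [substLie_of, hs]
    funext j
    fin_cases j <;> simp [freeD, freePull, Finset.sum_range_succ, pow_succ, coface]
    · rw [h 2 2 {3} (by decide), h 2 0 {0} (by decide), h 3 0 {0} (by decide),
        h 3 2 {2, 3} (by decide), h 4 2 {2} (by decide), h 4 0 {0} (by decide)]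
      rw [Finset.sum_pair (by decide)]
      simp only [Finset.sum_singleton, lie_add]
      rw [← lie_skew (FreeLieAlgebra.of k 0) (FreeLieAlgebra.of k 2),
        ← lie_skew (FreeLieAlgebra.of k 0) (FreeLieAlgebra.of k 3)]
      abel
    · rw [h 0 2 {3} (by decide), h 0 0 {1} (by decide), h 1 0 {0, 1} (by decide),
        h 1 2 {3} (by decide), h 2 2 {3} (by decide), h 2 0 {0} (by decide)]
      rw [Finset.sum_pair (by decide)]
      simp only [Finset.sum_singleton, add_lie]
      rw [← lie_skew (FreeLieAlgebra.of k 0) (FreeLieAlgebra.of k 3),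
        ← lie_skew (FreeLieAlgebra.of k 1) (FreeLieAlgebra.of k 3)]
      abel
  · exact freeD_zero

section

attribute [local instance 100] LieRing.ofAssociativeRing

/-- Only the words `y z x` and `y x z` contribute. Their coefficients `1` and `-1` enter the hexagon
with opposite signs and therefore add up. -/
theorem altCoeff_zxElt : altCoeff (zxElt k) = 2 := by
  have h : ∀ i j a b : Fin 3,
      wordCoeff (FreeAlgebra.ι k i * FreeAlgebra.ι k j) [some a, some b] =
        if a = i then if b = j then 1 else 0 else 0 := by
    intro i j a b
    rw [← mul_one (FreeAlgebra.ι k j), wordCoeff_ι_mul, wordCoeff_ι_mul, letterAct_cons,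
      letterAct_cons, wordCoeff_one]
    simp
  rw [altCoeff_apply, tupleComp_zxElt, if_pos rfl]
  simp [hexagonSum, tupleCoeff, word3, toAssoc, LieRing.of_associative_ring_bracket, h]
  norm_num

end

end
end TangentialDer

theorem mainTheorem6 (k : Type*) [Field k] [CharZero k] :
    (Function.Bijective ((TangentialDer.coboundaries k 2).submoduleOf
        (LinearMap.ker (TangentialDer.d k 2))).mkQ ∧
      LinearMap.ker (TangentialDer.d k 2) =
        Submodule.span k {TangentialDer.r k, TangentialDer.t k} ∧
      LinearIndependent k ![TangentialDer.r k, TangentialDer.t k]) ∧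
    (Module.finrank k (TangentialDer.cohomology k 3) = 1 ∧
      ∃ h : TangentialDer.zxElt k ∈ LinearMap.ker (TangentialDer.d k 3),
        (Submodule.Quotient.mk ⟨TangentialDer.zxElt k, h⟩ : TangentialDer.cohomology k 3) ≠ 0 ∧
        Submodule.span k
          {(Submodule.Quotient.mk ⟨TangentialDer.zxElt k, h⟩ : TangentialDer.cohomology k 3)} =
            ⊤) := by
  have hne : (Submodule.Quotient.mk ⟨TangentialDer.zxElt k, TangentialDer.zxElt_mem_ker⟩ :
      TangentialDer.cohomology k 3) ≠ 0 := by
    intro h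
    rw [Submodule.Quotient.mk_eq_zero, Submodule.submoduleOf, Submodule.mem_comap] at h
    obtain ⟨v, hv⟩ := h
    have h2 := TangentialDer.altCoeff_zxElt (k := k)
    have h3 := TangentialDer.altCoeff_d v
    rw [hv] at h3
    exact two_ne_zero (h2.symm.trans h3)
  have hspan : ∀ w : TangentialDer.cohomology k 3, ∃ c : k,
      c • (Submodule.Quotient.mk ⟨TangentialDer.zxElt k, TangentialDer.zxElt_mem_ker⟩ :
        TangentialDer.cohomology k 3) = w := by
    intro w
    obtain ⟨⟨u, hu⟩, rfl⟩ := Submodule.Quotient.mk_surjective _ w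
    -- The multiple of the cocycle with the same `altCoeff` as `u`; the difference is then a
    -- coboundary.
    refine ⟨TangentialDer.altCoeff u / 2, ?_⟩
    rw [← Submodule.Quotient.mk_smul, Submodule.Quotient.eq, Submodule.submoduleOf, Submodule.mem_comap]
    refine TangentialDer.mem_range_of_altCoeff_eq_zero ?_ ?_
    · exact Submodule.sub_mem _ (Submodule.smul_mem _ _ TangentialDer.zxElt_mem_ker) hu
    simp [TangentialDer.altCoeff_zxElt]
  refine ⟨⟨TangentialDer.bijective_mkQ_coboundaries_two, TangentialDer.ker_d_two,
    TangentialDer.linearIndependent_r_t⟩, finrank_eq_one _ hne hspan,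
    TangentialDer.zxElt_mem_ker, hne, ?_⟩
  rw [Submodule.eq_top_iff']
  exact fun w => Submodule.mem_span_singleton.2 (hspan w)
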